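/- Let $\Omega\subset\mathbb{R}^n$ be compact, equal to the closure of its interior, with $0$ in its interior, and fix a parameter $\alpha\in\mathbb{R}^q$. Consider the system $\dot x=f(x,\alpha)+g(x,\alpha)u$, $x(0)=x_0\in\Omega$, with $f(x,\alpha)\in\mathbb{R}^n$ and $g(x,\alpha)\in\mathbb{R}^{n\times p}$ smooth and Lipschitz in $x$ on $\Omega$ and $f(0,\alpha)=0$, and the performance index $$V(x_0,u,\alpha)=\lim_{T\to\infty}\int_0^T\big[u(x(t))^{\top}Ru(x(t))+m(x(t),\alpha)\big]\,dt ,$$ where $R$ is symmetric positive definite and $m(\cdot,\alpha)$ is smooth, Lipschitz, positive definite and radially nondecreasing on $\Omega$, with positive definite Hessian $Q$ at the origin. A control law $u:\Omega\to\mathbb{R}^p$ is admissible if it is continuous, $u(0)=0$, and for each $x_0\in\Omega$ the closed loop has a solution that stays in $\Omega$ for all $t\ge 0$, all such solutions tend to $0$ as $t\to\infty$, and the performance index is finite along them. Let $\phi(x)$, $x\in\Omega$, be the minimum of $V(x,u,\alpha)$ over the admissible control laws; assume that one admissible control law attains this minimum for all $x\in\Omega$, and that $\phi$ is continuously differentiable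 on $\Omega$ (it is the restriction to $\Omega$ of a function that is $C^1$ near each point of $\Omega$). Assume that, for some $\rho>0$, the gradients with respect to $x$ of (the components of) $f$, $g$ and $m$ are bounded and Lipschitz on $D=\{x\in\Omega:\|x\|<\rho\}$; that the pair $\big[\frac{\partial f}{\partial x}(0,\alpha),g(0,\alpha)\big]$ is completely controllable; and that the pair $\big[\frac{\partial f}{\partial x}(0,\alpha),Q^{1/2}\big]$ is completely observable. Then the feedback law $u^*(x)=-\frac12R^{-1}g(x,\alpha)^{\top}\nabla_x\phi(x)$ makes the origin uniformly globally asymptotically and locally exponentially stable on $\Omega$: for each $x_0\in\Omega$ the closed loop $\dot x=f(x,\alpha)+g(x,\alpha)u^*(x)$ has a solution that stays in $\Omega$ for all $t\ge0$, and there are a continuous nondecreasing function $\beta>0$ and a number $\lambda>0$, independent of $x_0$, such that every such solution satisfies $$\|x(t)\|\le\beta(\|x_0\|)\,\|x_0\|\,e^{-\lambda t}\qquad\text{for all }t\ge0 .$$ -/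

import Mathlib

open scoped ContDiff MatrixOrder Matrix.Norms.L2Operator
open Filter Topology Set

/-- Data of a parameter-dependent infinite-horizon optimal control problem: the state region `Ω`,
the dynamics `ẋ = f(x,α) + g(x,α) u`, and the running cost `uᵀ R u + m(x,α)`. Only the values of
`f`, `g`, `m` at states in (a neighbourhood of) `Ω` matter. -/
structure ControlProblem (n p q : ℕ) where
  /-- the region of states -/
  Ω : Set (EuclideanSpace ℝ (Fin n))
  /-- the drift -/
  f : EuclideanSpace ℝ (Fin n) → EuclideanSpace ℝ (Fin q) → EuclideanSpace ℝ (Fin n)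
  /-- the input matrix -/
  g : EuclideanSpace ℝ (Fin n) → EuclideanSpace ℝ (Fin q) → Matrix (Fin n) (Fin p) ℝ
  /-- the state cost -/
  m : EuclideanSpace ℝ (Fin n) → EuclideanSpace ℝ (Fin q) → ℝ
  /-- the control weight -/
  R : Matrix (Fin p) (Fin p) ℝ

/-- The pair `(A, B)` is completely controllable: on every time interval, a smooth control steers
`ẋ = A x + B u` from any given state to any other given state. -/
def CompletelyControllable {n p : ℕ} (A : Matrix (Fin n) (Fin n) ℝ)
    (B : Matrix (Fin n) (Fin p) ℝ) : Prop :=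
  ∀ (t₀ t₁ : ℝ), t₀ < t₁ → ∀ x₀ x₁ : EuclideanSpace ℝ (Fin n),
    ∃ (u : ℝ → EuclideanSpace ℝ (Fin p)) (x : ℝ → EuclideanSpace ℝ (Fin n)),
      ContDiff ℝ ∞ u ∧ x t₀ = x₀ ∧ x t₁ = x₁ ∧
      ∀ t ∈ Icc t₀ t₁, HasDerivWithinAt x
        (WithLp.toLp 2 (A.mulVec (x t).ofLp + B.mulVec (u t).ofLp)) (Icc t₀ t₁) t

/-- The pair `(A, C)` is completely observable: the output `C x` of `ẋ = A x` on any time interval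
determines the initial state. -/
def CompletelyObservable {n k : ℕ} (A : Matrix (Fin n) (Fin n) ℝ)
    (C : Matrix (Fin k) (Fin n) ℝ) : Prop :=
  ∀ (t₀ t₁ : ℝ), t₀ < t₁ → ∀ x y : ℝ → EuclideanSpace ℝ (Fin n),
    (∀ t ∈ Icc t₀ t₁, HasDerivWithinAt x (WithLp.toLp 2 (A.mulVec (x t).ofLp)) (Icc t₀ t₁) t) →
    (∀ t ∈ Icc t₀ t₁, HasDerivWithinAt y (WithLp.toLp 2 (A.mulVec (y t).ofLp)) (Icc t₀ t₁) t) →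
    (∀ t ∈ Icc t₀ t₁, C.mulVec (x t).ofLp = C.mulVec (y t).ofLp) → x t₀ = y t₀

/-- The Jacobian matrix of `h` at `x`. -/
noncomputable def jacobianMatrix {n : ℕ}
    (h : EuclideanSpace ℝ (Fin n) → EuclideanSpace ℝ (Fin n)) (x : EuclideanSpace ℝ (Fin n)) :
    Matrix (Fin n) (Fin n) ℝ :=
  Matrix.of fun i j => fderiv ℝ h x (EuclideanSpace.single j 1) i

/-- The Hessian matrix of `h` at `x`. -/
noncomputable def hessianMatrix {n : ℕ}
    (h : EuclideanSpace ℝ (Fin n) → ℝ) (x : EuclideanSpace ℝ (Fin n)) :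
    Matrix (Fin n) (Fin n) ℝ :=
  Matrix.of fun i j =>
    fderiv ℝ (fderiv ℝ h) x (EuclideanSpace.single i 1) (EuclideanSpace.single j 1)

/-- The gradient of `h` is bounded and Lipschitz on `D`. -/
def BoundedLipschitzGradientOn {n : ℕ} (h : EuclideanSpace ℝ (Fin n) → ℝ)
    (D : Set (EuclideanSpace ℝ (Fin n))) : Prop :=
  (∃ C : ℝ, ∀ x ∈ D, ‖gradient h x‖ ≤ C) ∧ ∃ K : NNReal, LipschitzOnWith K (gradient h) D

namespace ControlProblem

variable {n p q : ℕ} (P : ControlProblem n p q) (α : EuclideanSpace ℝ (Fin q))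

/-- The regularity and definiteness assumptions on the data of the problem, at the parameter `α`.
Smoothness on the closed set `Ω` is smoothness at each point of `Ω`; since `Ω` is the closure of
its interior, all derivatives at points of `Ω` are determined by the values on `Ω`. -/
structure StandingAssumptions : Prop where
  isCompact_Ω : IsCompact P.Ω
  closure_interior_Ω : closure (interior P.Ω) = P.Ω
  zero_mem : (0 : EuclideanSpace ℝ (Fin n)) ∈ interior P.Ω
  smooth_f : ∀ x ∈ P.Ω, ContDiffAt ℝ ∞ (fun y => P.f y α) x
  smooth_g : ∀ i j, ∀ x ∈ P.Ω, ContDiffAt ℝ ∞ (fun y => P.g y α i j) x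
  smooth_m : ∀ x ∈ P.Ω, ContDiffAt ℝ ∞ (fun y => P.m y α) x
  lipschitz_f : ∃ K : NNReal, LipschitzOnWith K (fun y => P.f y α) P.Ω
  lipschitz_g : ∀ i j, ∃ K : NNReal, LipschitzOnWith K (fun y => P.g y α i j) P.Ω
  lipschitz_m : ∃ K : NNReal, LipschitzOnWith K (fun y => P.m y α) P.Ω
  f_zero : P.f 0 α = 0
  m_zero : P.m 0 α = 0
  m_pos : ∀ x ∈ P.Ω, x ≠ 0 → 0 < P.m x α
  m_radially_increasing : ∀ (x : EuclideanSpace ℝ (Fin n)) (s t : ℝ), 0 ≤ s → s ≤ t →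
    s • x ∈ P.Ω → t • x ∈ P.Ω → P.m (s • x) α ≤ P.m (t • x) α
  m_hessian : (hessianMatrix (fun y => P.m y α) 0).PosDef
  R_posDef : P.R.PosDef

/-- The velocity `f(x,α) + g(x,α) v`. -/
noncomputable def velocity (x : EuclideanSpace ℝ (Fin n)) (v : EuclideanSpace ℝ (Fin p)) :
    EuclideanSpace ℝ (Fin n) :=
  P.f x α + WithLp.toLp 2 ((P.g x α).mulVec v.ofLp)

/-- `x` is a solution in `Ω`, on `[0, ∞)`, of the closed loop under the control law `u`,
with initial state `x₀`. -/
def IsTrajectory (u : EuclideanSpace ℝ (Fin n) → EuclideanSpace ℝ (Fin p))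
    (x₀ : EuclideanSpace ℝ (Fin n)) (x : ℝ → EuclideanSpace ℝ (Fin n)) : Prop :=
  x 0 = x₀ ∧ ∀ t : ℝ, 0 ≤ t →
    x t ∈ P.Ω ∧ HasDerivWithinAt x (P.velocity α (x t) (u (x t))) (Ici 0) t

/-- The running cost `vᵀ R v + m(x,α)`. -/
noncomputable def runningCost (x : EuclideanSpace ℝ (Fin n)) (v : EuclideanSpace ℝ (Fin p)) : ℝ :=
  v.ofLp ⬝ᵥ P.R.mulVec v.ofLp + P.m x α

/-- The performance index along `x` under the law `u` is finite and equal to `c`. -/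
def HasCost (u : EuclideanSpace ℝ (Fin n) → EuclideanSpace ℝ (Fin p))
    (x : ℝ → EuclideanSpace ℝ (Fin n)) (c : ℝ) : Prop :=
  Tendsto (fun T : ℝ => ∫ t in (0 : ℝ)..T, P.runningCost α (x t) (u (x t))) atTop (𝓝 c)

/-- Admissible control laws. -/
structure IsAdmissible (u : EuclideanSpace ℝ (Fin n) → EuclideanSpace ℝ (Fin p)) : Prop where
  continuousOn : ContinuousOn u P.Ω
  map_zero : u 0 = 0
  exists_trajectory : ∀ x₀ ∈ P.Ω, ∃ x, P.IsTrajectory α u x₀ x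
  tendsto_zero : ∀ x₀ ∈ P.Ω, ∀ x, P.IsTrajectory α u x₀ x → Tendsto x atTop (𝓝 0)
  finite_cost : ∀ x₀ ∈ P.Ω, ∀ x, P.IsTrajectory α u x₀ x → ∃ c, P.HasCost α u x c

/-- On `Ω`, `φ` is the minimum of the performance index over the admissible control laws, and the
minimum is attained, for all initial states, by one admissible law. -/
def IsMinimumIndex (φ : EuclideanSpace ℝ (Fin n) → ℝ) : Prop :=
  (∀ u, P.IsAdmissible α u → ∀ x₀ ∈ P.Ω, ∀ x, P.IsTrajectory α u x₀ x →
    ∀ c, P.HasCost α u x c → φ x₀ ≤ c) ∧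
  ∃ u, P.IsAdmissible α u ∧ ∀ x₀ ∈ P.Ω, ∀ x, P.IsTrajectory α u x₀ x → P.HasCost α u x (φ x₀)

/-- The control law `u*(x) = -½ R⁻¹ g(x,α)ᵀ ∇φ(x)`. -/
noncomputable def optimalLaw (φ : EuclideanSpace ℝ (Fin n) → ℝ)
    (x : EuclideanSpace ℝ (Fin n)) : EuclideanSpace ℝ (Fin p) :=
  (-(1 / 2 : ℝ)) • WithLp.toLp 2
    (P.R⁻¹.mulVec ((P.g x α).transpose.mulVec (gradient φ x).ofLp))

/-- The origin is uniformly globally asymptotically and locally exponentially stable on the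
invariant set `Ω` for the closed loop under `u`. -/
def IsUGALES (u : EuclideanSpace ℝ (Fin n) → EuclideanSpace ℝ (Fin p)) : Prop :=
  (∀ x₀ ∈ P.Ω, ∃ x, P.IsTrajectory α u x₀ x) ∧
  ∃ (β : ℝ → ℝ) (lam : ℝ), Monotone β ∧ Continuous β ∧ (∀ r, 0 < β r) ∧ 0 < lam ∧
    ∀ x₀ ∈ P.Ω, ∀ x, P.IsTrajectory α u x₀ x →
      ∀ t : ℝ, 0 ≤ t → ‖x t‖ ≤ β ‖x₀‖ * ‖x₀‖ * Real.exp (-lam * t)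

end ControlProblem

/-! The value function `φ` is a Lyapunov function trapped between two multiples of `‖x‖²`, and `u*`
is on `Ω` the only optimal law.

Let `u` be an optimal admissible law and let the Hamiltonian `H(x, v)` be the derivative of `φ`
along the velocity plus the running cost. Dynamic programming gives `H(x, u x) = 0`
(`hamiltonian_eq_zero`). The running cost dominates `‖x‖² + ‖v‖²`, which both bounds `φ` below by a
multiple of `‖x‖²` (`exists_mul_sq_norm_le_value`) and makes `φ` decrease along trajectories.

The main point is `H ≥ 0` for every control value (`hamiltonian_nonneg`). If `H(x₁, v) < 0` at an
interior `x₁ ≠ 0`, bend `u` towards `v` near `x₁`. By convexity the new law has `H ≤ 0`, and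
Nagumo's theorem (`exists_viable_solution`) gives it solutions in `Ω`, since its field on the
boundary is unchanged. With `φ` as Lyapunov function it is admissible, and it is cheaper than `φ
x₁`: a contradiction. The other points of `Ω` follow from `∇φ(0) = 0` and continuity. Completing the
square in `v` then forces `u = u*` on `Ω`.

Integrating `H ≥ 0` along curves that steer the linearized system to `0` gives `φ ≤ C‖x‖²`
(`exists_value_le_mul_sq_norm`). Hence `φ' ≤ -(d/C) φ` along trajectories, and the decay is
exponential. -/

/-! ### Nagumo's viability theorem by Euler approximation. -/

section Viability

variable {E : Type*} [NormedAddCommGroup E] [NormedSpace ℝ E] {K : Set E} {F : E → E}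

/-- On a compact set, the step sizes in the tangency condition can be bounded below. -/
theorem exists_uniform_step (hK : IsCompact K) (hF : ContinuousOn F K)
    (hT : ∀ x ∈ K, ∀ ε > 0, ∃ h, 0 < h ∧ h ≤ ε ∧ ∃ y ∈ K, ‖y - x - h • F x‖ ≤ ε * h)
    {ε : ℝ} (hε : 0 < ε) :
    ∃ η > 0, ∀ x ∈ K, ∃ h, η ≤ h ∧ h ≤ ε ∧ ∃ y ∈ K, ‖y - x - h • F x‖ ≤ ε * h := by
  refine hK.induction_on (p := fun S => ∃ η > 0, ∀ x ∈ S, ∃ h, η ≤ h ∧ h ≤ ε ∧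
    ∃ y ∈ K, ‖y - x - h • F x‖ ≤ ε * h) ⟨1, one_pos, by simp⟩ ?_ ?_ ?_
  · rintro s t hst ⟨η, hη, h⟩
    exact ⟨η, hη, fun x hx => h x (hst hx)⟩
  · rintro s t ⟨η, hη, h⟩ ⟨η', hη', h'⟩
    refine ⟨min η η', lt_min hη hη', ?_⟩
    rintro x (hx | hx)
    · obtain ⟨k, hk, hr⟩ := h x hx
      exact ⟨k, (min_le_left _ _).trans hk, hr⟩
    · obtain ⟨k, hk, hr⟩ := h' x hx
      exact ⟨k, (min_le_right _ _).trans hk, hr⟩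
  · intro x hx
    -- The step and target point found at `x` also serve all `z` near `x`. The three thirds of `ε`
    -- pay for the defect at `x`, for `z - x`, and for `F z - F x`.
    obtain ⟨h, h0, hle, y, hy, hxy⟩ := hT x hx (ε / 3) (by positivity)
    have h1 : ∀ᶠ z in 𝓝[K] x, ‖F z - F x‖ < ε / 3 := by
      simpa [dist_eq_norm] using (hF x hx).eventually (Metric.ball_mem_nhds _ (by positivity))
    have h2 : ∀ᶠ z in 𝓝[K] x, ‖z - x‖ < ε / 3 * h := by
      filter_upwards [nhdsWithin_le_nhds
        (Metric.ball_mem_nhds x (show 0 < ε / 3 * h by positivity))] with z hz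
      rwa [Metric.mem_ball, dist_eq_norm] at hz
    refine ⟨_, h1.and h2, h, h0, ?_⟩
    rintro z ⟨hz1, hz2⟩
    refine ⟨h, le_rfl, by linarith, y, hy, ?_⟩
    have e : y - z - h • F z = (y - x - h • F x) - (z - x) - h • (F z - F x) := by
      rw [smul_sub]; abel
    have h3 : ‖h • (F z - F x)‖ ≤ h * (ε / 3) := by
      rw [norm_smul, Real.norm_of_nonneg h0.le]; gcongr
    rw [e]
    have h4 := norm_sub_le ((y - x - h • F x) - (z - x)) (h • (F z - F x))
    have h5 := norm_sub_le (y - x - h • F x) (z - x)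
    nlinarith

/-- An Euler scheme that stays in `K`. -/
theorem exists_euler_scheme (hK : IsCompact K) (hF : ContinuousOn F K)
    (hT : ∀ x ∈ K, ∀ ε > 0, ∃ h, 0 < h ∧ h ≤ ε ∧ ∃ y ∈ K, ‖y - x - h • F x‖ ≤ ε * h)
    {ε : ℝ} (hε : 0 < ε) {x₀ : E} (hx₀ : x₀ ∈ K) :
    ∃ (T : ℕ → ℝ) (X : ℕ → E), T 0 = 0 ∧ X 0 = x₀ ∧ (∀ k, X k ∈ K) ∧ StrictMono T ∧
      Tendsto T atTop atTop ∧ (∀ k, T (k + 1) - T k ≤ ε) ∧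
      ∀ k, ‖X (k + 1) - X k - (T (k + 1) - T k) • F (X k)‖ ≤ ε * (T (k + 1) - T k) := by
  obtain ⟨η, hη, hstep⟩ := exists_uniform_step hK hF hT hε
  choose! h h1 h2 y hy h3 using hstep
  let X : ℕ → E := fun k => y^[k] x₀
  have hX : ∀ k, X (k + 1) = y (X k) := fun k => Function.iterate_succ_apply' _ _ _
  have hXK : ∀ k, X k ∈ K := by
    intro k
    induction k with
    | zero => exact hx₀
    | succ k ih => rw [hX]; exact hy _ ih
  let T : ℕ → ℝ := fun k => ∑ j ∈ Finset.range k, h (X j)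
  have hTs : ∀ k, T (k + 1) - T k = h (X k) := fun k => by
    simp [T, Finset.sum_range_succ]
  -- The uniform lower bound on the steps keeps the node times from accumulating.
  have hTk : ∀ k : ℕ, k * η ≤ T k := by
    intro k
    induction k with
    | zero => simp [T]
    | succ k ih =>
      have := hTs k
      have := h1 _ (hXK k)
      push_cast
      linarith
  refine ⟨T, X, by simp [T], rfl, hXK, strictMono_nat_of_lt_succ fun k => ?_, ?_, fun k => ?_,
    fun k => ?_⟩
  · have := hTs k
    have := h1 _ (hXK k)
    linarith
  · exact tendsto_atTop_mono hTk (tendsto_natCast_atTop_atTop.atTop_mul_const hη)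
  · rw [hTs]; exact h2 _ (hXK k)
  · rw [hTs, hX]; exact h3 _ (hXK k)

theorem euler_scheme_dist_le {ε M : ℝ} {T : ℕ → ℝ} {X : ℕ → E} (hM : ∀ x ∈ K, ‖F x‖ ≤ M)
    (hX : ∀ k, X k ∈ K) (hTm : StrictMono T)
    (hs : ∀ k, ‖X (k + 1) - X k - (T (k + 1) - T k) • F (X k)‖ ≤ ε * (T (k + 1) - T k))
    {i j : ℕ} (hij : i ≤ j) : ‖X j - X i‖ ≤ (M + ε) * (T j - T i) := by
  induction j, hij using Nat.le_induction with
  | base => simp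
  | succ j hij ih =>
    have h0 : 0 < T (j + 1) - T j := sub_pos.2 (hTm (Nat.lt_succ_self j))
    have e : X (j + 1) - X i = (X (j + 1) - X j - (T (j + 1) - T j) • F (X j))
        + (T (j + 1) - T j) • F (X j) + (X j - X i) := by abel
    have h1 : ‖(T (j + 1) - T j) • F (X j)‖ ≤ (T (j + 1) - T j) * M := by
      rw [norm_smul, Real.norm_of_nonneg h0.le]; gcongr; exact hM _ (hX j)
    rw [e]
    refine (norm_add₃_le).trans ?_
    linarith [hs j]

/-- While the scheme stays within `r` of `X i`, replacing `F (X j)` by `F (X i)` costs at most `δ`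
per unit time; the defects of the steps add `ε`. -/
theorem euler_scheme_error_le {ε M δ r : ℝ} {T : ℕ → ℝ} {X : ℕ → E} (hM : ∀ x ∈ K, ‖F x‖ ≤ M)
    (hM0 : 0 ≤ M) (hε : 0 ≤ ε)
    (hX : ∀ k, X k ∈ K) (hTm : StrictMono T)
    (hs : ∀ k, ‖X (k + 1) - X k - (T (k + 1) - T k) • F (X k)‖ ≤ ε * (T (k + 1) - T k))
    (hδ : ∀ a ∈ K, ∀ b ∈ K, ‖a - b‖ < r → ‖F a - F b‖ ≤ δ)
    {i j : ℕ} (hij : i ≤ j) (hr : (M + ε) * (T j - T i) < r) :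
    ‖X j - X i - (T j - T i) • F (X i)‖ ≤ (ε + δ) * (T j - T i) := by
  induction j, hij using Nat.le_induction with
  | base => simp
  | succ j hij ih =>
    have h0 : 0 < T (j + 1) - T j := sub_pos.2 (hTm (Nat.lt_succ_self j))
    have hr' : (M + ε) * (T j - T i) < r := lt_of_le_of_lt (by gcongr; linarith) hr
    have e : X (j + 1) - X i - (T (j + 1) - T i) • F (X i)
        = (X (j + 1) - X j - (T (j + 1) - T j) • F (X j))
        + (T (j + 1) - T j) • (F (X j) - F (X i)) + (X j - X i - (T j - T i) • F (X i)) := by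
      module
    have h1 : ‖(T (j + 1) - T j) • (F (X j) - F (X i))‖ ≤ (T (j + 1) - T j) * δ := by
      rw [norm_smul, Real.norm_of_nonneg h0.le]; gcongr
      exact hδ _ (hX j) _ (hX i) ((euler_scheme_dist_le hM hX hTm hs hij).trans_lt hr')
    rw [e]
    refine (norm_add₃_le).trans ?_
    linarith [hs j, ih hr']

/-- A step function in `K` that solves `ẋ = F x` up to an error `ε`. -/
theorem exists_approximate_solution (hK : IsCompact K) (hF : ContinuousOn F K)
    (hT : ∀ x ∈ K, ∀ ε > 0, ∃ h, 0 < h ∧ h ≤ ε ∧ ∃ y ∈ K, ‖y - x - h • F x‖ ≤ ε * h)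
    {M : ℝ} (hM : ∀ x ∈ K, ‖F x‖ ≤ M) (hM0 : 0 ≤ M)
    {ε : ℝ} (hε : 0 < ε) {x₀ : E} (hx₀ : x₀ ∈ K) :
    ∃ y : ℝ → E, y 0 = x₀ ∧ (∀ s, 0 ≤ s → y s ∈ K) ∧
      ∀ δ r, (∀ a ∈ K, ∀ b ∈ K, ‖a - b‖ < r → ‖F a - F b‖ ≤ δ) →
        ∀ s t, 0 ≤ s → s ≤ t → (M + ε) * (t - s + ε) < r →
          ‖y t - y s - (t - s) • F (y s)‖ ≤ (ε + δ) * (t - s + ε) + ε * M := by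
  obtain ⟨T, X, hT0, hX0, hXK, hTm, hTt, hTε, hs⟩ := exists_euler_scheme hK hF hT hε hx₀
  have hk : ∀ s : ℝ, 0 ≤ s → ∃ k, T k ≤ s ∧ s < T (k + 1) := by
    intro s hs0
    have hex : ∃ k, s < T k := (hTt.eventually_gt_atTop s).exists
    classical
    have h1 := Nat.find_spec hex
    have h2 : Nat.find hex ≠ 0 := by
      intro h; rw [h, hT0] at h1; linarith
    obtain ⟨k, hk⟩ := Nat.exists_eq_succ_of_ne_zero h2
    refine ⟨k, not_lt.1 (Nat.find_min hex (by omega)), ?_⟩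
    rwa [hk] at h1
  choose! κ hκ1 hκ2 using hk
  refine ⟨fun s => X (κ s), ?_, fun s _ => hXK _, ?_⟩
  · have h1 : κ 0 = 0 := by
      by_contra h
      have := hTm (Nat.pos_of_ne_zero h)
      have := hκ1 0 le_rfl
      linarith
    simp [h1, hX0]
  · intro δ r hδ s t hs0 hst hr
    have ht0 := hs0.trans hst
    have hle : κ s ≤ κ t := by
      have : T (κ s) < T (κ t + 1) := ((hκ1 s hs0).trans hst).trans_lt (hκ2 t ht0)
      have := hTm.lt_iff_lt.1 this
      omega
    have a1 := hκ1 s hs0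
    have a2 := hκ2 s hs0
    have a3 := hκ1 t ht0
    have a4 := hκ2 t ht0
    have a5 := hTε (κ s)
    have a6 := hTε (κ t)
    -- Rounding `s` and `t` down to nodes changes the elapsed time by at most `ε`, which also
    -- accounts for the extra term `ε * M`.
    have hd : T (κ t) - T (κ s) ≤ t - s + ε := by linarith
    have hd0 : 0 ≤ T (κ t) - T (κ s) := sub_nonneg.2 (hTm.monotone hle)
    have h1 := euler_scheme_error_le hM hM0 hε.le hXK hTm hs hδ hle
      (lt_of_le_of_lt (by gcongr) hr)
    have hrpos : 0 < r := lt_of_le_of_lt (mul_nonneg (by linarith) (by linarith)) hr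
    have hδ0 : 0 ≤ δ := (norm_nonneg _).trans (hδ _ hx₀ _ hx₀ (by simpa using hrpos))
    have e : X (κ t) - X (κ s) - (t - s) • F (X (κ s))
        = (X (κ t) - X (κ s) - (T (κ t) - T (κ s)) • F (X (κ s)))
          + (T (κ t) - T (κ s) - (t - s)) • F (X (κ s)) := by module
    have h2 : ‖(T (κ t) - T (κ s) - (t - s)) • F (X (κ s))‖ ≤ ε * M := by
      rw [norm_smul]
      gcongr
      · rw [Real.norm_eq_abs, abs_le]; constructor <;> linarith
      · exact hM _ (hXK _)
    show ‖X (κ t) - X (κ s) - (t - s) • F (X (κ s))‖ ≤ _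
    rw [e]
    refine (norm_add_le _ _).trans (add_le_add (h1.trans ?_) h2)
    gcongr

/-- Nagumo's viability theorem: a continuous vector field on a compact set `K` that is
subtangential to `K` has solutions in `K`, on `[0, ∞)`, from all initial states in `K`. -/
theorem exists_viable_solution (hK : IsCompact K) (hF : ContinuousOn F K)
    (hT : ∀ x ∈ K, ∀ ε > 0, ∃ h, 0 < h ∧ h ≤ ε ∧ ∃ y ∈ K, ‖y - x - h • F x‖ ≤ ε * h)
    {x₀ : E} (hx₀ : x₀ ∈ K) :
    ∃ x : ℝ → E, x 0 = x₀ ∧ ∀ t, 0 ≤ t → x t ∈ K ∧ HasDerivWithinAt x (F (x t)) (Ici 0) t := by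
  obtain ⟨M, hM⟩ := hK.exists_bound_of_continuousOn hF
  have hM0 : 0 ≤ M := (norm_nonneg _).trans (hM _ hx₀)
  have hpos : ∀ k : ℕ, (0 : ℝ) < 1 / ((k : ℝ) + 1) := fun k => Nat.one_div_pos_of_nat
  choose y hy0 hyK hy using fun k : ℕ => exists_approximate_solution hK hF hT hM hM0 (hpos k) hx₀
  -- Along one free ultrafilter, compactness of `K` gives limits at all times simultaneously, with
  -- no extraction of subsequences and no continuity of the step functions.
  let U : Ultrafilter ℕ := hyperfilter ℕ
  have hU : (U : Filter ℕ) ≤ atTop := Nat.hyperfilter_le_atTop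
  have hε : Tendsto (fun k : ℕ => 1 / ((k : ℝ) + 1)) U (𝓝 0) :=
    (tendsto_one_div_add_atTop_nhds_zero_nat (𝕜 := ℝ)).mono_left hU
  have hlim : ∀ s : ℝ, 0 ≤ s → ∃ a ∈ K, Tendsto (fun k => y k s) U (𝓝 a) := by
    intro s hs
    have := hK.ultrafilter_le_nhds (U.map fun k => y k s) (by
      rw [Ultrafilter.coe_map, le_principal_iff, mem_map]
      exact Filter.univ_mem' fun k => hyK k s hs)
    exact this
  choose! x hxK hx using hlim
  have hFx : ∀ s, 0 ≤ s → Tendsto (fun k => F (y k s)) U (𝓝 (F (x s))) := fun s hs =>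
    (hF _ (hxK s hs)).tendsto.comp
      (tendsto_nhdsWithin_iff.2 ⟨hx s hs, Eventually.of_forall fun k => hyK k s hs⟩)
  have key : ∀ δ r, (∀ a ∈ K, ∀ b ∈ K, ‖a - b‖ < r → ‖F a - F b‖ ≤ δ) →
      ∀ s t, 0 ≤ s → s ≤ t → M * (t - s) < r →
        ‖x t - x s - (t - s) • F (x s)‖ ≤ δ * (t - s) := by
    intro δ r hδ s t hs hst hr
    have l1 : Tendsto (fun k => ‖y k t - y k s - (t - s) • F (y k s)‖) U
        (𝓝 ‖x t - x s - (t - s) • F (x s)‖) :=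
      (((hx t (hs.trans hst)).sub (hx s hs)).sub ((hFx s hs).const_smul _)).norm
    have l2 : Tendsto (fun k : ℕ => (1 / ((k : ℝ) + 1) + δ) * (t - s + 1 / ((k : ℝ) + 1))
        + 1 / ((k : ℝ) + 1) * M) U (𝓝 ((0 + δ) * (t - s + 0) + 0 * M)) :=
      ((hε.add_const _).mul (hε.const_add _)).add (hε.mul_const _)
    have l3 : Tendsto (fun k : ℕ => (M + 1 / ((k : ℝ) + 1)) * (t - s + 1 / ((k : ℝ) + 1))) U
        (𝓝 ((M + 0) * (t - s + 0))) := (hε.const_add _).mul (hε.const_add _)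
    have l4 := l3.eventually_lt_const (show (M + 0) * (t - s + 0) < r by simpa using hr)
    have := le_of_tendsto_of_tendsto l1 l2 (l4.mono fun k hk => hy k δ r hδ s t hs hst hk)
    simpa using this
  have hosc : ∀ δ > 0, ∃ r > 0, ∀ a ∈ K, ∀ b ∈ K, ‖a - b‖ < r → ‖F a - F b‖ ≤ δ := by
    intro δ hδ
    obtain ⟨r, hr, h⟩ := Metric.uniformContinuousOn_iff.1
      (hK.uniformContinuousOn_of_continuous hF) δ hδ
    exact ⟨r, hr, fun a ha b hb hab => by
      simpa [dist_eq_norm] using (h a ha b hb (by simpa [dist_eq_norm] using hab)).le⟩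
  refine ⟨x, ?_, fun t ht => ⟨hxK t ht, ?_⟩⟩
  · have h1 := hx 0 le_rfl
    simp only [hy0] at h1
    exact tendsto_nhds_unique h1 tendsto_const_nhds
  · rw [hasDerivWithinAt_iff_isLittleO, Asymptotics.isLittleO_iff]
    intro c hc
    obtain ⟨r, hr, hosc⟩ := hosc (c / 2) (by positivity)
    -- Small enough both for `key` and for `‖x s - x t‖ ≤ (M + c / 2) |s - t| < r`.
    have hnear : ∀ᶠ s in 𝓝[Ici 0] t, |s - t| < r / (M + c + 1) := by
      refine nhdsWithin_le_nhds (Metric.ball_mem_nhds t ?_)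
      positivity
    filter_upwards [hnear, self_mem_nhdsWithin] with s hs hs0
    have hs0 : 0 ≤ s := hs0
    have hb : (M + c + 1) * |s - t| < r := by
      rw [lt_div_iff₀ (by positivity)] at hs; linarith
    have h0 := abs_nonneg (s - t)
    have hb' : M * |s - t| < r := by nlinarith
    rcases le_total t s with hts | hst
    · rw [abs_of_nonneg (by linarith)] at *
      refine (key _ r hosc t s ht hts hb').trans ?_
      rw [Real.norm_of_nonneg h0]
      nlinarith
    -- `key` uses the velocity at the left endpoint, here `s`. Exchanging it for the velocity at `t`
    -- costs the second half of `c`.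
    · rw [abs_sub_comm, abs_of_nonneg (by linarith)] at *
      have h1 := key _ r hosc s t hs0 hst hb'
      have h2 : ‖(t - s) • F (x s)‖ ≤ (t - s) * M := by
        rw [norm_smul, Real.norm_of_nonneg h0]; gcongr; exact hM _ (hxK s hs0)
      have h3 : ‖x s - x t‖ < r := by
        have e : x s - x t = -((x t - x s - (t - s) • F (x s)) + (t - s) • F (x s)) := by abel
        rw [e, norm_neg]
        refine (norm_add_le _ _).trans_lt ?_
        nlinarith
      have h4 := hosc _ (hxK s hs0) _ (hxK t ht) h3
      have h5 : ‖(t - s) • (F (x s) - F (x t))‖ ≤ (t - s) * (c / 2) := by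
        rw [norm_smul, Real.norm_of_nonneg h0]; gcongr
      have e : x s - x t - (s - t) • F (x t)
          = -((x t - x s - (t - s) • F (x s)) + (t - s) • (F (x s) - F (x t))) := by module
      rw [e, norm_neg, show ‖s - t‖ = t - s by
        rw [Real.norm_eq_abs, abs_sub_comm, abs_of_nonneg h0]]
      refine (norm_add_le _ _).trans ?_
      linarith

end Viability

/-! ### Bounds for quadratic forms and matrices. -/

section QuadraticForms

theorem Matrix.PosDef.exists_mul_sq_norm_le {k : ℕ} {M : Matrix (Fin k) (Fin k) ℝ}
    (hM : M.PosDef) :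
    ∃ c > 0, ∀ v : EuclideanSpace ℝ (Fin k), c * ‖v‖ ^ 2 ≤ v.ofLp ⬝ᵥ M.mulVec v.ofLp := by
  have hcont : Continuous fun v : EuclideanSpace ℝ (Fin k) => v.ofLp ⬝ᵥ M.mulVec v.ofLp := by
    fun_prop
  rcases (Metric.sphere (0 : EuclideanSpace ℝ (Fin k)) 1).eq_empty_or_nonempty with he | hne
  -- The unit sphere is empty only in dimension zero; otherwise the constant is the minimum of the
  -- form on it.
  · refine ⟨1, one_pos, fun v => ?_⟩
    by_cases hv : v = 0
    · simp [hv]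
    · have : ‖v‖⁻¹ • v ∈ Metric.sphere (0 : EuclideanSpace ℝ (Fin k)) 1 := by
        simp [norm_smul, hv]
      simp [he] at this
  · obtain ⟨w, hw, hmin⟩ := (isCompact_sphere (0 : EuclideanSpace ℝ (Fin k)) 1).exists_isMinOn hne
      hcont.continuousOn
    have hw1 : ‖w‖ = 1 := by simpa using hw
    refine ⟨w.ofLp ⬝ᵥ M.mulVec w.ofLp, ?_, fun v => ?_⟩
    · refine hM.dotProduct_mulVec_pos (x := w.ofLp) fun h => ?_
      have : w = 0 := by ext i; simp [h]
      simp [this] at hw1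
    · by_cases hv : v = 0
      · simp [hv]
      · have hs : ‖v‖⁻¹ • v ∈ Metric.sphere (0 : EuclideanSpace ℝ (Fin k)) 1 := by
          simp [norm_smul, hv]
        have h1 := hmin hs
        simp only [mem_ofPred_eq, WithLp.ofLp_smul, Matrix.mulVec_smul, dotProduct_smul,
          smul_dotProduct, smul_eq_mul] at h1
        have hv0 : 0 < ‖v‖ := norm_pos_iff.2 hv
        calc _ ≤ ‖v‖⁻¹ * (‖v‖⁻¹ * (v.ofLp ⬝ᵥ M.mulVec v.ofLp)) * ‖v‖ ^ 2 := by gcongr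
          _ = _ := by field_simp

theorem norm_toLp_mulVec_le {k l : ℕ} (A : Matrix (Fin k) (Fin l) ℝ)
    (v : EuclideanSpace ℝ (Fin l)) :
    ‖WithLp.toLp 2 (A.mulVec v.ofLp)‖ ≤ (∑ i, ∑ j, |A i j|) * ‖v‖ := by
  have h1 : ∀ w : EuclideanSpace ℝ (Fin k), ‖w‖ ≤ ∑ i, |w i| := by
    intro w
    conv_lhs => rw [← (EuclideanSpace.basisFun (Fin k) ℝ).sum_repr w]
    refine (norm_sum_le _ _).trans (Finset.sum_le_sum fun i _ => ?_)
    simp [norm_smul]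
  refine (h1 _).trans ?_
  rw [Finset.sum_mul]
  refine Finset.sum_le_sum fun i _ => ?_
  rw [Finset.sum_mul]
  change |∑ j, A i j * v j| ≤ _
  refine (Finset.abs_sum_le_sum_abs (fun j => A i j * v j) _).trans
    (Finset.sum_le_sum fun j _ => ?_)
  rw [abs_mul]
  gcongr
  exact PiLp.norm_apply_le v j

theorem exists_dotProduct_mulVec_le {k : ℕ} (M : Matrix (Fin k) (Fin k) ℝ) :
    ∃ C, 0 ≤ C ∧ ∀ v : EuclideanSpace ℝ (Fin k), v.ofLp ⬝ᵥ M.mulVec v.ofLp ≤ C * ‖v‖ ^ 2 := by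
  refine ⟨∑ i, ∑ j, |M i j|, by positivity, fun v => ?_⟩
  have h1 := real_inner_le_norm (WithLp.toLp 2 (M.mulVec v.ofLp)) v
  rw [EuclideanSpace.inner_eq_star_dotProduct] at h1
  simp only [star_trivial] at h1
  have h2 := norm_toLp_mulVec_le M v
  nlinarith [norm_nonneg v]

end QuadraticForms

/-! ### Second-order estimates at the origin. -/

section Taylor

variable {E G : Type*} [NormedAddCommGroup E] [NormedSpace ℝ E] [NormedAddCommGroup G]
  [NormedSpace ℝ G]

theorem ContDiffAt.exists_taylor_one_remainder_le {f : E → G} (hf : ContDiffAt ℝ 2 f 0) :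
    ∃ C r : ℝ, 0 ≤ C ∧ 0 < r ∧
      ∀ z, ‖z‖ < r → ‖f z - f 0 - fderiv ℝ f 0 z‖ ≤ C * ‖z‖ ^ 2 := by
  have h1 : ContDiffAt ℝ 1 (fderiv ℝ f) 0 := hf.fderiv_right (by norm_num)
  obtain ⟨C, t, ht, hC⟩ := h1.exists_lipschitzOnWith
  have h2 : ∀ᶠ z in 𝓝 (0 : E), DifferentiableAt ℝ f z :=
    (hf.eventually (by simp)).mono fun z hz => hz.differentiableAt (by norm_num)
  obtain ⟨r, hr, hball⟩ := Metric.mem_nhds_iff.1 (inter_mem ht h2)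
  refine ⟨C, r, C.2, hr, fun z hz => ?_⟩
  have hsub : Metric.closedBall (0 : E) ‖z‖ ⊆ Metric.ball 0 r :=
    Metric.closedBall_subset_ball hz
  have := Convex.norm_image_sub_le_of_norm_hasFDerivWithin_le' (f := f) (𝕜 := ℝ)
    (f' := fderiv ℝ f) (φ := fderiv ℝ f 0) (C := C * ‖z‖) (s := Metric.closedBall (0 : E) ‖z‖)
    (x := 0) (y := z)
    (fun x hx => (hball (hsub hx)).2.hasFDerivAt.hasFDerivWithinAt) (fun x hx => ?_)
    (convex_closedBall _ _) (by simp) (by simp)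
  · simpa [pow_two, mul_assoc] using this
  · have h3 := hC.dist_le_mul x (hball (hsub hx)).1 0 (hball (Metric.mem_ball_self hr)).1
    rw [dist_eq_norm] at h3
    exact h3.trans (by gcongr; simpa using hx)

/-- A positive definite second derivative at a critical point gives quadratic growth. -/
theorem ContDiffAt.exists_quadratic_growth {h : E → ℝ} (hh : ContDiffAt ℝ 2 h 0) (h0 : h 0 = 0)
    (h1 : fderiv ℝ h 0 = 0) {c : ℝ} (hc : 0 < c)
    (hQ : ∀ z, c * ‖z‖ ^ 2 ≤ fderiv ℝ (fderiv ℝ h) 0 z z) :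
    ∃ r > 0, ∀ z, ‖z‖ < r → c / 4 * ‖z‖ ^ 2 ≤ h z := by
  have hd : HasFDerivAt (fderiv ℝ h) (fderiv ℝ (fderiv ℝ h) 0) 0 :=
    ((hh.fderiv_right (m := 1) (by norm_num)).differentiableAt (by norm_num)).hasFDerivAt
  have h2 : ∀ᶠ z in 𝓝 (0 : E), DifferentiableAt ℝ h z :=
    (hh.eventually (by simp)).mono fun z hz => hz.differentiableAt (by norm_num)
  have h3 := (hasFDerivAt_iff_isLittleO_nhds_zero.1 hd).def (c := c / 2) (by positivity)
  simp only [h1, zero_add, sub_zero] at h3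
  obtain ⟨r, hr, hball⟩ := Metric.mem_nhds_iff.1 (inter_mem h3 h2)
  refine ⟨r, hr, fun z hz => ?_⟩
  have hmem : ∀ t ∈ Icc (0 : ℝ) 1, t • z ∈ Metric.ball (0 : E) r := by
    intro t ht
    rw [mem_ball_zero_iff, norm_smul, Real.norm_of_nonneg ht.1]
    exact (mul_le_of_le_one_left (norm_nonneg _) ht.2).trans_lt hz
  have hder : ∀ t ∈ Icc (0 : ℝ) 1, HasDerivAt (fun t : ℝ => h (t • z) - c / 4 * t ^ 2 * ‖z‖ ^ 2)
      (fderiv ℝ h (t • z) z - c / 2 * t * ‖z‖ ^ 2) t := by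
    intro t ht
    have e1 : HasDerivAt (fun t : ℝ => t • z) z t := by
      simpa using (hasDerivAt_id t).smul_const z
    have e2 := (hball (hmem t ht)).2.hasFDerivAt.comp_hasDerivAt t e1
    have e3 := ((hasDerivAt_pow 2 t).const_mul (c / 4)).mul_const (‖z‖ ^ 2)
    refine (e2.sub e3).congr_deriv ?_
    simp only [Nat.cast_ofNat, Nat.add_one_sub_one, pow_one]
    ring
  -- The second derivative contributes slope at least `c t ‖z‖²`. Half is lost to the
  -- differentiability error of `fderiv ℝ h`, half to the subtracted square.
  have hmono : MonotoneOn (fun t : ℝ => h (t • z) - c / 4 * t ^ 2 * ‖z‖ ^ 2) (Icc 0 1) := by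
    refine monotoneOn_of_hasDerivWithinAt_nonneg (convex_Icc 0 1)
      (fun t ht => (hder t ht).continuousAt.continuousWithinAt)
      (fun t ht => (hder t (interior_subset ht)).hasDerivWithinAt) fun t ht => ?_
    have ht' := interior_subset ht
    have e1 := (hball (hmem t ht')).1
    simp only [mem_ofPred_eq] at e1
    have e2 := (fderiv ℝ h (t • z) - fderiv ℝ (fderiv ℝ h) 0 (t • z)).le_opNorm z
    have e3 : ‖(fderiv ℝ h (t • z) - fderiv ℝ (fderiv ℝ h) 0 (t • z)) z‖ ≤
        c / 2 * (t * ‖z‖) * ‖z‖ := by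
      refine e2.trans ?_
      gcongr
      rwa [norm_smul, Real.norm_of_nonneg ht'.1] at e1
    have e4 := (abs_le.1 e3).1
    have e5 := mul_le_mul_of_nonneg_left (hQ z) ht'.1
    simp at e4
    linarith
  have := hmono (by simp) (by simp) zero_le_one
  simp [h0] at this
  exact this

end Taylor

theorem toLp_jacobianMatrix_mulVec {n : ℕ}
    (h : EuclideanSpace ℝ (Fin n) → EuclideanSpace ℝ (Fin n)) (x z : EuclideanSpace ℝ (Fin n)) :
    WithLp.toLp 2 ((jacobianMatrix h x).mulVec z.ofLp) = fderiv ℝ h x z := by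
  conv_rhs => rw [← (EuclideanSpace.basisFun (Fin n) ℝ).sum_repr z]
  ext i
  simp [jacobianMatrix, Matrix.mulVec, dotProduct, mul_comm]

theorem dotProduct_hessianMatrix_mulVec {n : ℕ}
    (h : EuclideanSpace ℝ (Fin n) → ℝ) (x z : EuclideanSpace ℝ (Fin n)) :
    z.ofLp ⬝ᵥ (hessianMatrix h x).mulVec z.ofLp = fderiv ℝ (fderiv ℝ h) x z z := by
  conv_rhs => rw [← (EuclideanSpace.basisFun (Fin n) ℝ).sum_repr z]
  simp only [hessianMatrix, Matrix.mulVec, dotProduct, Matrix.of_apply, map_sum, map_smul,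
    EuclideanSpace.basisFun_apply, EuclideanSpace.basisFun_repr, sum_apply,
    smul_apply, smul_eq_mul, Finset.mul_sum]
  rw [Finset.sum_comm]
  exact Finset.sum_congr rfl fun i _ => Finset.sum_congr rfl fun j _ => by ring

/-! ### Estimates for the velocity and the running cost. -/

namespace ControlProblem

variable {n p q : ℕ} {P : ControlProblem n p q} {α : EuclideanSpace ℝ (Fin q)}

theorem velocity_add_smul (x : EuclideanSpace ℝ (Fin n)) (v w : EuclideanSpace ℝ (Fin p)) (s : ℝ) :
    P.velocity α x (v + s • w) =
      P.velocity α x v + s • WithLp.toLp 2 ((P.g x α).mulVec w.ofLp) := by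
  simp only [velocity, WithLp.ofLp_add, WithLp.ofLp_smul, Matrix.mulVec_add, Matrix.mulVec_smul,
    WithLp.toLp_add, WithLp.toLp_smul]
  abel

namespace StandingAssumptions

variable (hP : P.StandingAssumptions α)
include hP

theorem mem_nhds : P.Ω ∈ 𝓝 (0 : EuclideanSpace ℝ (Fin n)) := mem_interior_iff_mem_nhds.1 hP.zero_mem

theorem continuousOn_velocity {u : EuclideanSpace ℝ (Fin n) → EuclideanSpace ℝ (Fin p)}
    (hu : ContinuousOn u P.Ω) : ContinuousOn (fun x => P.velocity α x (u x)) P.Ω := by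
  refine ContinuousOn.add (fun x hx => (hP.smooth_f x hx).continuousAt.continuousWithinAt) ?_
  refine (PiLp.continuous_toLp 2 _).comp_continuousOn (continuousOn_pi.2 fun i => ?_)
  change ContinuousOn (fun y => ∑ j, P.g y α i j * u y j) P.Ω
  refine continuousOn_finsetSum _ fun j _ => ContinuousOn.mul
    (f := fun y => P.g y α i j) (g := fun y => u y j) (fun x hx => (hP.smooth_g i j x hx).continuousAt.continuousWithinAt) ?_
  exact (EuclideanSpace.proj (𝕜 := ℝ) j).continuous.comp_continuousOn hu

theorem continuousOn_runningCost {u : EuclideanSpace ℝ (Fin n) → EuclideanSpace ℝ (Fin p)}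
    (hu : ContinuousOn u P.Ω) : ContinuousOn (fun x => P.runningCost α x (u x)) P.Ω := by
  have h : Continuous fun v : EuclideanSpace ℝ (Fin p) => v.ofLp ⬝ᵥ P.R.mulVec v.ofLp := by
    fun_prop
  exact (h.comp_continuousOn hu).add
    fun x hx => (hP.smooth_m x hx).continuousAt.continuousWithinAt

/-- The drift is Lipschitz and vanishes at `0`, and `g` is bounded on the compact `Ω`. -/
theorem exists_norm_velocity_le :
    ∃ K, 0 ≤ K ∧ ∀ x ∈ P.Ω, ∀ v, ‖P.velocity α x v‖ ≤ K * (‖x‖ + ‖v‖) := by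
  have h0 : (0 : EuclideanSpace ℝ (Fin n)) ∈ P.Ω := interior_subset hP.zero_mem
  obtain ⟨K, hK⟩ := hP.lipschitz_f
  choose C hC using fun i j => hP.isCompact_Ω.exists_bound_of_continuousOn
    fun x hx => (hP.smooth_g i j x hx).continuousAt.continuousWithinAt
  have hC0 : 0 ≤ ∑ i, ∑ j, C i j := Finset.sum_nonneg fun i _ => Finset.sum_nonneg fun j _ =>
    (norm_nonneg _).trans (hC i j 0 h0)
  refine ⟨K + ∑ i, ∑ j, C i j, by positivity, fun x hx v => (norm_add_le _ _).trans ?_⟩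
  have h1 : ‖P.f x α‖ ≤ K * ‖x‖ := by
    simpa [dist_eq_norm, hP.f_zero] using hK.dist_le_mul x hx 0 h0
  have h2 : ∑ i, ∑ j, |P.g x α i j| ≤ ∑ i, ∑ j, C i j :=
    Finset.sum_le_sum fun i _ => Finset.sum_le_sum fun j _ => hC i j x hx
  have h3 := norm_toLp_mulVec_le (P.g x α) v
  have h4 := mul_le_mul_of_nonneg_right h2 (norm_nonneg v)
  have h5 := mul_nonneg hC0 (norm_nonneg x)
  have h6 := mul_nonneg K.2 (norm_nonneg v)
  simp only [NNReal.val_eq_coe] at h6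
  nlinarith

/-- The velocity field agrees with its linearization at the origin up to second order. -/
theorem exists_norm_velocity_sub_linearization_le :
    ∃ C r : ℝ, 0 ≤ C ∧ 0 < r ∧ ∀ z, ‖z‖ < r → ∀ v : EuclideanSpace ℝ (Fin p),
      ‖P.velocity α z v - WithLp.toLp 2 ((jacobianMatrix (fun y => P.f y α) 0).mulVec z.ofLp
        + (P.g 0 α).mulVec v.ofLp)‖ ≤ C * (‖z‖ + ‖v‖) * ‖z‖ := by
  have h0 : (0 : EuclideanSpace ℝ (Fin n)) ∈ P.Ω := interior_subset hP.zero_mem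
  obtain ⟨C, r, hC, hr, hf⟩ :=
    ((hP.smooth_f 0 h0).of_le (m := 2) (by norm_cast)).exists_taylor_one_remainder_le
  obtain ⟨r', hr', hball⟩ := Metric.mem_nhds_iff.1 hP.mem_nhds
  choose K hK using hP.lipschitz_g
  refine ⟨C + ∑ i, ∑ j, (K i j : ℝ), min r r', by positivity, lt_min hr hr', fun z hz v => ?_⟩
  have hzΩ : z ∈ P.Ω := hball (mem_ball_zero_iff.2 (hz.trans_le (min_le_right _ _)))
  have h1 := hf z (hz.trans_le (min_le_left _ _))
  have h2 := norm_toLp_mulVec_le (P.g z α - P.g 0 α) v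
  have h3 : ∑ i, ∑ j, |(P.g z α - P.g 0 α) i j| ≤ (∑ i, ∑ j, (K i j : ℝ)) * ‖z‖ := by
    rw [Finset.sum_mul]
    refine Finset.sum_le_sum fun i _ => ?_
    rw [Finset.sum_mul]
    refine Finset.sum_le_sum fun j _ => ?_
    simpa [dist_eq_norm] using (hK i j).dist_le_mul z hzΩ 0 h0
  have e : P.velocity α z v - WithLp.toLp 2 ((jacobianMatrix (fun y => P.f y α) 0).mulVec z.ofLp
        + (P.g 0 α).mulVec v.ofLp) = (P.f z α - P.f 0 α - fderiv ℝ (fun y => P.f y α) 0 z)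
        + WithLp.toLp 2 ((P.g z α - P.g 0 α).mulVec v.ofLp) := by
    rw [WithLp.toLp_add, toLp_jacobianMatrix_mulVec, Matrix.sub_mulVec, WithLp.toLp_sub, hP.f_zero,
      velocity]
    abel
  rw [e]
  refine (norm_add_le _ _).trans ?_
  have h4 := mul_le_mul_of_nonneg_right h3 (norm_nonneg v)
  have h5 : 0 ≤ C * (‖v‖ * ‖z‖) := by positivity
  have h6 : 0 ≤ (∑ i, ∑ j, (K i j : ℝ)) * (‖z‖ * ‖z‖) := by positivity
  nlinarith

theorem m_nonneg {x : EuclideanSpace ℝ (Fin n)} (hx : x ∈ P.Ω) : 0 ≤ P.m x α := by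
  by_cases h : x = 0
  · rw [h, hP.m_zero]
  · exact (hP.m_pos x hx h).le

theorem fderiv_m_zero : fderiv ℝ (fun y => P.m y α) 0 = 0 := by
  refine IsLocalMin.fderiv_eq_zero ?_
  filter_upwards [hP.mem_nhds] with x hx
  simpa only [hP.m_zero] using hP.m_nonneg hx

theorem contDiffAt_m_zero : ContDiffAt ℝ 2 (fun y => P.m y α) 0 :=
  (hP.smooth_m 0 (interior_subset hP.zero_mem)).of_le (by norm_cast)

/-- The state cost grows at least quadratically on the whole region. -/
theorem exists_mul_sq_norm_le_m : ∃ c > 0, ∀ x ∈ P.Ω, c * ‖x‖ ^ 2 ≤ P.m x α := by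
  obtain ⟨c, hc, hQ⟩ := hP.m_hessian.exists_mul_sq_norm_le
  obtain ⟨r, hr, hm⟩ := hP.contDiffAt_m_zero.exists_quadratic_growth hP.m_zero hP.fderiv_m_zero hc
    fun z => by rw [← dotProduct_hessianMatrix_mulVec]; exact hQ z
  obtain ⟨M, hM⟩ := hP.isCompact_Ω.isBounded.exists_norm_le
  have hM0 : 0 ≤ M := (norm_nonneg _).trans (hM 0 (interior_subset hP.zero_mem))
  have hcomp : IsCompact (P.Ω \ Metric.ball 0 r) := hP.isCompact_Ω.diff Metric.isOpen_ball
  -- The Hessian only controls a ball around `0`; on the compact remainder `m` has a positive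
  -- minimum, compared below with `‖x‖² ≤ M ^ 2 + 1`.
  obtain ⟨μ, hμ, hμm⟩ : ∃ μ > 0, ∀ x ∈ P.Ω \ Metric.ball 0 r, μ ≤ P.m x α := by
    rcases (P.Ω \ Metric.ball 0 r).eq_empty_or_nonempty with he | hne
    · exact ⟨1, one_pos, by simp [he]⟩
    · obtain ⟨w, hw, hmin⟩ := hcomp.exists_isMinOn hne (f := fun y => P.m y α)
        fun x hx => (hP.smooth_m x hx.1).continuousAt.continuousWithinAt
      refine ⟨P.m w α, hP.m_pos w hw.1 ?_, fun x hx => hmin hx⟩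
      rintro rfl
      exact hw.2 (Metric.mem_ball_self hr)
  refine ⟨min (c / 4) (μ / (M ^ 2 + 1)), by positivity, fun x hx => ?_⟩
  by_cases hxr : ‖x‖ < r
  · refine le_trans ?_ (hm x hxr)
    gcongr
    exact min_le_left _ _
  · refine le_trans ?_ (hμm x ⟨hx, by simpa using hxr⟩)
    calc _ ≤ μ / (M ^ 2 + 1) * (M ^ 2 + 1) := by
          gcongr
          · exact min_le_right _ _
          · have := hM x hx
            nlinarith [norm_nonneg x]
      _ = μ := by field_simp

theorem exists_mul_le_runningCost :
    ∃ c > 0, ∀ x ∈ P.Ω, ∀ v, c * (‖x‖ ^ 2 + ‖v‖ ^ 2) ≤ P.runningCost α x v := by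
  obtain ⟨c, hc, hm⟩ := hP.exists_mul_sq_norm_le_m
  obtain ⟨d, hd, hR⟩ := hP.R_posDef.exists_mul_sq_norm_le
  refine ⟨min c d, lt_min hc hd, fun x hx v => ?_⟩
  have h1 := hm x hx
  have h2 := hR v
  have h3 : min c d * ‖x‖ ^ 2 ≤ c * ‖x‖ ^ 2 := by gcongr; exact min_le_left _ _
  have h4 : min c d * ‖v‖ ^ 2 ≤ d * ‖v‖ ^ 2 := by gcongr; exact min_le_right _ _
  unfold runningCost
  linarith

theorem runningCost_nonneg {x : EuclideanSpace ℝ (Fin n)} (hx : x ∈ P.Ω)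
    (v : EuclideanSpace ℝ (Fin p)) : 0 ≤ P.runningCost α x v := by
  obtain ⟨c, hc, h⟩ := hP.exists_mul_le_runningCost
  exact le_trans (by positivity) (h x hx v)

theorem exists_runningCost_le :
    ∃ C r : ℝ, 0 ≤ C ∧ 0 < r ∧ ∀ x, ‖x‖ < r → ∀ v : EuclideanSpace ℝ (Fin p),
      P.runningCost α x v ≤ C * (‖x‖ ^ 2 + ‖v‖ ^ 2) := by
  obtain ⟨C, r, hC, hr, hm⟩ := hP.contDiffAt_m_zero.exists_taylor_one_remainder_le
  obtain ⟨D, hD, hR⟩ := exists_dotProduct_mulVec_le P.R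
  refine ⟨C + D, r, by positivity, hr, fun x hx v => ?_⟩
  have h1 := hm x hx
  rw [hP.fderiv_m_zero, hP.m_zero] at h1
  have h2 : P.m x α ≤ C * ‖x‖ ^ 2 := (le_abs_self _).trans (by simpa using h1)
  have h3 := hR v
  have h4 : 0 ≤ D * ‖x‖ ^ 2 := by positivity
  have h5 : 0 ≤ C * ‖v‖ ^ 2 := by positivity
  unfold runningCost
  linarith

end StandingAssumptions

end ControlProblem

theorem antitoneOn_Ici_of_hasDerivWithinAt_nonpos {a : ℝ} {f f' : ℝ → ℝ}
    (hf : ∀ t, a ≤ t → HasDerivWithinAt f (f' t) (Ici a) t) (hf' : ∀ t, a ≤ t → f' t ≤ 0) :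
    AntitoneOn f (Ici a) :=
  antitoneOn_of_hasDerivWithinAt_nonpos (convex_Ici a)
    (fun t ht => (hf t ht).continuousWithinAt)
    (fun t ht => (hf t (interior_subset ht)).mono interior_subset)
    fun t ht => hf' t (interior_subset ht)

theorem ContinuousOn.hasDerivWithinAt_integral_Ici {f : ℝ → ℝ} (hf : ContinuousOn f (Ici 0))
    {t : ℝ} (ht : 0 ≤ t) :
    HasDerivWithinAt (fun T => ∫ s in (0 : ℝ)..T, f s) (f t) (Ici 0) t := by
  -- Freezing `f` at negative times gives a function continuous on the whole line, without changing
  -- the integrals over `[0, T]`.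
  have hc : Continuous fun s => f (max 0 s) :=
    hf.comp_continuous (by fun_prop) fun s => mem_Ici.2 (le_max_left _ _)
  have h1 := (hc.integral_hasStrictDerivAt 0 t).hasDerivAt.hasDerivWithinAt (s := Ici 0)
  rw [max_eq_right ht] at h1
  have h2 : ∀ T ∈ Ici (0 : ℝ), ∫ s in (0 : ℝ)..T, f s = ∫ s in (0 : ℝ)..T, f (max 0 s) := by
    intro T hT
    refine intervalIntegral.integral_congr fun s hs => ?_
    rw [uIcc_of_le hT] at hs
    simp only [max_eq_right hs.1]
  exact h1.congr h2 (h2 t ht)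

/-! ### The Hamiltonian, and calculus along trajectories. -/

namespace ControlProblem

variable {n p q : ℕ} {P : ControlProblem n p q} {α : EuclideanSpace ℝ (Fin q)}
  {u : EuclideanSpace ℝ (Fin n) → EuclideanSpace ℝ (Fin p)}
  {φ : EuclideanSpace ℝ (Fin n) → ℝ} {x₀ : EuclideanSpace ℝ (Fin n)}
  {x : ℝ → EuclideanSpace ℝ (Fin n)}

/-- The derivative of `φ` along the velocity, plus the running cost. -/
noncomputable def hamiltonian (P : ControlProblem n p q) (α : EuclideanSpace ℝ (Fin q))
    (φ : EuclideanSpace ℝ (Fin n) → ℝ) (x : EuclideanSpace ℝ (Fin n))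
    (v : EuclideanSpace ℝ (Fin p)) : ℝ :=
  fderiv ℝ φ x (P.velocity α x v) + P.runningCost α x v

theorem hamiltonian_add_smul (y : EuclideanSpace ℝ (Fin n)) (v w : EuclideanSpace ℝ (Fin p))
    (s : ℝ) :
    P.hamiltonian α φ y (v + s • w) = P.hamiltonian α φ y v
      + s * (fderiv ℝ φ y (WithLp.toLp 2 ((P.g y α).mulVec w.ofLp))
        + w.ofLp ⬝ᵥ P.R.mulVec v.ofLp + v.ofLp ⬝ᵥ P.R.mulVec w.ofLp)
      + s ^ 2 * (w.ofLp ⬝ᵥ P.R.mulVec w.ofLp) := by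
  simp only [hamiltonian, velocity_add_smul, runningCost, map_add, map_smul, smul_eq_mul,
    WithLp.ofLp_add, WithLp.ofLp_smul, Matrix.mulVec_add, Matrix.mulVec_smul, dotProduct_add,
    add_dotProduct, smul_dotProduct, dotProduct_smul]
  ring

/-- The Hamiltonian is quadratic in the control, so the gap between chord and value is `s (1 - s)`
times the `R`-form of `w - v`. -/
theorem hamiltonian_convex (hR : P.R.PosDef) (y : EuclideanSpace ℝ (Fin n))
    (v w : EuclideanSpace ℝ (Fin p)) {s : ℝ} (hs0 : 0 ≤ s) (hs1 : s ≤ 1) :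
    P.hamiltonian α φ y (v + s • (w - v)) ≤
      (1 - s) * P.hamiltonian α φ y v + s * P.hamiltonian α φ y w := by
  have h1 := hamiltonian_add_smul (P := P) (α := α) (φ := φ) y v (w - v) s
  have h2 := hamiltonian_add_smul (P := P) (α := α) (φ := φ) y v (w - v) 1
  rw [one_smul, add_sub_cancel] at h2
  obtain ⟨c, hc, hcR⟩ := hR.exists_mul_sq_norm_le
  have h3 : 0 ≤ (w - v).ofLp ⬝ᵥ P.R.mulVec (w - v).ofLp := le_trans (by positivity) (hcR _)
  have h4 : 0 ≤ s * (1 - s) * ((w - v).ofLp ⬝ᵥ P.R.mulVec (w - v).ofLp) :=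
    mul_nonneg (mul_nonneg hs0 (by linarith)) h3
  rw [h1, h2]
  linarith

/-- The law `u*` minimizes the Hamiltonian. -/
theorem hamiltonian_optimalLaw_add (hR : P.R.PosDef) (y : EuclideanSpace ℝ (Fin n))
    (w : EuclideanSpace ℝ (Fin p)) :
    P.hamiltonian α φ y (P.optimalLaw α φ y + w) =
      P.hamiltonian α φ y (P.optimalLaw α φ y) + w.ofLp ⬝ᵥ P.R.mulVec w.ofLp := by
  have h1 := hamiltonian_add_smul (P := P) (α := α) (φ := φ) y (P.optimalLaw α φ y) w 1
  rw [one_smul] at h1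
  -- This is the stationarity condition: it cancels the part of the expansion linear in `w`.
  have hRv : P.R.mulVec (P.optimalLaw α φ y).ofLp =
      (-(1 / 2 : ℝ)) • (P.g y α).transpose.mulVec (gradient φ y).ofLp := by
    simp only [optimalLaw, WithLp.ofLp_smul, Matrix.mulVec_smul, Matrix.mulVec_mulVec]
    rw [← Matrix.mul_assoc, Matrix.mul_nonsing_inv _ ((Matrix.isUnit_iff_isUnit_det _).1 hR.isUnit), Matrix.one_mul]
  have h2 : fderiv ℝ φ y (WithLp.toLp 2 ((P.g y α).mulVec w.ofLp)) =
      w.ofLp ⬝ᵥ (P.g y α).transpose.mulVec (gradient φ y).ofLp := by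
    rw [← inner_gradient_left, EuclideanSpace.inner_eq_star_dotProduct, star_trivial,
      Matrix.mulVec_transpose, dotProduct_comm w.ofLp, ← Matrix.dotProduct_mulVec, dotProduct_comm]
  have h3 : (P.optimalLaw α φ y).ofLp ⬝ᵥ P.R.mulVec w.ofLp =
      w.ofLp ⬝ᵥ P.R.mulVec (P.optimalLaw α φ y).ofLp := by
    have hT : P.R.transpose = P.R := by simpa using hR.isHermitian.eq
    rw [Matrix.dotProduct_mulVec, dotProduct_comm, ← Matrix.mulVec_transpose, hT]
  rw [h1, h2, h3, hRv]
  simp only [dotProduct_smul, smul_eq_mul]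
  ring

namespace IsTrajectory

theorem congr {u' : EuclideanSpace ℝ (Fin n) → EuclideanSpace ℝ (Fin p)}
    (hx : P.IsTrajectory α u x₀ x) (h : EqOn u u' P.Ω) : P.IsTrajectory α u' x₀ x :=
  ⟨hx.1, fun t ht => ⟨(hx.2 t ht).1, by rw [← h (hx.2 t ht).1]; exact (hx.2 t ht).2⟩⟩

variable (hx : P.IsTrajectory α u x₀ x)
include hx

theorem mem {t : ℝ} (ht : 0 ≤ t) : x t ∈ P.Ω := (hx.2 t ht).1

theorem continuousOn : ContinuousOn x (Ici 0) := fun t ht => (hx.2 t ht).2.continuousWithinAt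

theorem shift {s : ℝ} (hs : 0 ≤ s) : P.IsTrajectory α u (x s) fun t => x (s + t) := by
  refine ⟨by simp, fun t ht => ⟨hx.mem (add_nonneg hs ht), ?_⟩⟩
  have h1 := (hx.2 (s + t) (add_nonneg hs ht)).2
  have h2 : HasDerivWithinAt (fun t : ℝ => s + t) 1 (Ici 0) t :=
    ((hasDerivAt_id t).const_add s).hasDerivWithinAt
  exact (h1.scomp (t' := Ici 0) t h2 fun r hr => add_nonneg hs hr).congr_deriv (one_smul _ _)

theorem hasDerivWithinAt_comp (hφ : ∀ y ∈ P.Ω, DifferentiableAt ℝ φ y) {t : ℝ} (ht : 0 ≤ t) :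
    HasDerivWithinAt (fun s => φ (x s)) (fderiv ℝ φ (x t) (P.velocity α (x t) (u (x t))))
      (Ici 0) t :=
  (hφ _ (hx.mem ht)).hasFDerivAt.comp_hasDerivWithinAt t (hx.2 t ht).2

variable (hP : P.StandingAssumptions α)
include hP

variable (hu : ContinuousOn u P.Ω)
include hu

theorem continuousOn_runningCost :
    ContinuousOn (fun t => P.runningCost α (x t) (u (x t))) (Ici 0) :=
  (hP.continuousOn_runningCost hu).comp hx.continuousOn fun _ ht => hx.mem ht

/-- The sign of the Hamiltonian thus decides whether value plus cost already spent rises or falls.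
-/
theorem hasDerivWithinAt_value_add_cost (hφ : ∀ y ∈ P.Ω, DifferentiableAt ℝ φ y) {t : ℝ}
    (ht : 0 ≤ t) :
    HasDerivWithinAt (fun T => φ (x T) + ∫ s in (0 : ℝ)..T, P.runningCost α (x s) (u (x s)))
      (P.hamiltonian α φ (x t) (u (x t))) (Ici 0) t :=
  (hx.hasDerivWithinAt_comp hφ ht).add
    ((hx.continuousOn_runningCost hP hu).hasDerivWithinAt_integral_Ici ht)

theorem intervalIntegrable_runningCost {a b : ℝ} (ha : 0 ≤ a) (hb : 0 ≤ b) :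
    IntervalIntegrable (fun t => P.runningCost α (x t) (u (x t))) MeasureTheory.volume a b :=
  ((hx.continuousOn_runningCost hP hu).mono fun _ ht =>
    (le_min ha hb).trans ht.1).intervalIntegrable

end IsTrajectory

end ControlProblem

/-! ### Lyapunov arguments and dynamic programming. -/

namespace ControlProblem

variable {n p q : ℕ} {P : ControlProblem n p q} {α : EuclideanSpace ℝ (Fin q)}
  {u : EuclideanSpace ℝ (Fin n) → EuclideanSpace ℝ (Fin p)}
  {φ : EuclideanSpace ℝ (Fin n) → ℝ} {x₀ : EuclideanSpace ℝ (Fin n)}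
  {x : ℝ → EuclideanSpace ℝ (Fin n)}

/-- If `φ` is positive definite with nonpositive Hamiltonian, trajectories tend to the origin. -/
theorem IsTrajectory.tendsto_zero_of_hamiltonian_nonpos (hx : P.IsTrajectory α u x₀ x)
    (hP : P.StandingAssumptions α) (hφ : ∀ y ∈ P.Ω, DifferentiableAt ℝ φ y) (hφ0 : φ 0 = 0)
    {c : ℝ} (hc : 0 < c) (hφc : ∀ y ∈ P.Ω, c * ‖y‖ ^ 2 ≤ φ y)
    (hH : ∀ y ∈ P.Ω, P.hamiltonian α φ y (u y) ≤ 0) : Tendsto x atTop (𝓝 0) := by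
  obtain ⟨d, hd, hL⟩ := hP.exists_mul_le_runningCost
  have hφ' : ∀ t, 0 ≤ t →
      fderiv ℝ φ (x t) (P.velocity α (x t) (u (x t))) ≤ -(d * ‖x t‖ ^ 2) := by
    intro t ht
    have h1 := hH _ (hx.mem ht)
    have h2 := hL _ (hx.mem ht) (u (x t))
    have h3 : 0 ≤ d * ‖u (x t)‖ ^ 2 := by positivity
    unfold hamiltonian at h1
    linarith
  have hanti : AntitoneOn (fun t => φ (x t)) (Ici 0) :=
    antitoneOn_Ici_of_hasDerivWithinAt_nonpos (fun t ht => hx.hasDerivWithinAt_comp hφ ht)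
      fun t ht => (hφ' t ht).trans (neg_nonpos.2 (by positivity))
  -- Otherwise the trajectory stays outside some ball of radius `r`, so `φ` drops at rate at least
  -- `d * r ^ 2` and is used up by time `φ (x 0) / (d * r ^ 2)`.
  have hsmall : ∀ ε > 0, ∃ t, 0 ≤ t ∧ φ (x t) < ε := by
    intro ε hε
    by_contra! hcon
    have h0 : ∀ᶠ y in 𝓝 (0 : EuclideanSpace ℝ (Fin n)), φ y < ε :=
      (hφ 0 (interior_subset hP.zero_mem)).continuousAt.eventually_lt_const (by rwa [hφ0])
    obtain ⟨r, hr, hball⟩ := Metric.eventually_nhds_iff_ball.1 h0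
    have hxr : ∀ t, 0 ≤ t → r ≤ ‖x t‖ := by
      intro t ht
      by_contra! h
      exact (hball _ (mem_ball_zero_iff.2 h)).not_ge (hcon t ht)
    have h1 : AntitoneOn (fun t => φ (x t) + d * r ^ 2 * t) (Ici 0) := by
      refine antitoneOn_Ici_of_hasDerivWithinAt_nonpos (fun t ht =>
        (hx.hasDerivWithinAt_comp hφ ht).add
          ((hasDerivAt_id t).const_mul (d * r ^ 2)).hasDerivWithinAt) fun t ht => ?_
      have h2 : d * r ^ 2 ≤ d * ‖x t‖ ^ 2 := by
        have := hxr t ht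
        gcongr
      linarith [hφ' t ht]
    have hT : 0 ≤ φ (x 0) / (d * r ^ 2) :=
      div_nonneg (hε.le.trans (hcon 0 le_rfl)) (by positivity)
    have h3 := h1 (mem_Ici.2 le_rfl) (mem_Ici.2 hT) hT
    have h4 := hcon _ hT
    simp only [mul_zero, add_zero] at h3
    rw [mul_div_cancel₀ _ (by positivity : d * r ^ 2 ≠ 0)] at h3
    linarith
  rw [Metric.tendsto_atTop]
  intro ε hε
  obtain ⟨t, ht, hlt⟩ := hsmall (c * ε ^ 2) (by positivity)
  refine ⟨t, fun s hs => ?_⟩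
  have h1 := hanti (mem_Ici.2 ht) (mem_Ici.2 (ht.trans hs)) hs
  have h2 := hφc _ (hx.mem (ht.trans hs))
  have h3 : c * ‖x s‖ ^ 2 < c * ε ^ 2 := h2.trans_lt (lt_of_le_of_lt h1 hlt)
  rw [dist_zero_right]
  exact lt_of_pow_lt_pow_left₀ 2 hε.le (lt_of_mul_lt_mul_left h3 hc.le)

/-- If `φ ≥ 0` has nonpositive Hamiltonian, the cost of trajectories is finite. -/
theorem IsTrajectory.exists_hasCost_of_hamiltonian_nonpos (hx : P.IsTrajectory α u x₀ x)
    (hP : P.StandingAssumptions α) (hu : ContinuousOn u P.Ω)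
    (hφ : ∀ y ∈ P.Ω, DifferentiableAt ℝ φ y) (hφ0 : ∀ y ∈ P.Ω, 0 ≤ φ y)
    (hH : ∀ y ∈ P.Ω, P.hamiltonian α φ y (u y) ≤ 0) : ∃ c, P.HasCost α u x c := by
  have hanti := antitoneOn_Ici_of_hasDerivWithinAt_nonpos
    (fun t ht => hx.hasDerivWithinAt_value_add_cost hP hu hφ ht)
    (fun t ht => hH _ (hx.mem ht))
  have hbound : ∀ T, 0 ≤ T →
      ∫ s in (0 : ℝ)..T, P.runningCost α (x s) (u (x s)) ≤ φ (x 0) := by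
    intro T hT
    have h1 := hanti (mem_Ici.2 le_rfl) (mem_Ici.2 hT) hT
    have h2 := hφ0 _ (hx.mem hT)
    simp only [intervalIntegral.integral_same, add_zero] at h1
    linarith
  have hmono : MonotoneOn
      (fun T => ∫ s in (0 : ℝ)..T, P.runningCost α (x s) (u (x s))) (Ici 0) :=
    monotoneOn_of_hasDerivWithinAt_nonneg (convex_Ici 0)
      (fun t ht => ((hx.continuousOn_runningCost hP hu).hasDerivWithinAt_integral_Ici
        ht).continuousWithinAt)
      (fun t ht => ((hx.continuousOn_runningCost hP hu).hasDerivWithinAt_integral_Ici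
        (interior_subset ht)).mono interior_subset)
      fun t ht => hP.runningCost_nonneg (hx.mem (interior_subset ht)) _
  have hmono' : Monotone
      (fun T => ∫ s in (0 : ℝ)..(max 0 T), P.runningCost α (x s) (u (x s))) := fun a b hab =>
    hmono (mem_Ici.2 (le_max_left _ _)) (mem_Ici.2 (le_max_left _ _)) (max_le_max le_rfl hab)
  rcases tendsto_atTop_of_monotone hmono' with h | ⟨c, hc⟩
  · obtain ⟨T, hT⟩ := (h.eventually_gt_atTop (φ (x 0))).exists
    exact absurd (hbound _ (le_max_left 0 T)) hT.not_ge
  · refine ⟨c, hc.congr' ?_⟩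
    filter_upwards [eventually_ge_atTop 0] with T hT
    rw [max_eq_right hT]

section Optimal

variable (hP : P.StandingAssumptions α) (hu : P.IsAdmissible α u)
  (hopt : ∀ x₀ ∈ P.Ω, ∀ x, P.IsTrajectory α u x₀ x → P.HasCost α u x (φ x₀))
include hP hu hopt

theorem value_zero : φ 0 = 0 := by
  have h0 : (0 : EuclideanSpace ℝ (Fin n)) ∈ P.Ω := interior_subset hP.zero_mem
  have hz : P.IsTrajectory α u 0 fun _ => 0 := by
    refine ⟨rfl, fun t _ => ⟨h0, ?_⟩⟩
    have : P.velocity α 0 (u 0) = 0 := by simp [velocity, hu.map_zero, hP.f_zero]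
    simp only [this]
    exact hasDerivWithinAt_const _ _ _
  have h1 := hopt 0 h0 _ hz
  have h2 : P.runningCost α 0 (u 0) = 0 := by simp [runningCost, hu.map_zero, hP.m_zero]
  simp only [HasCost, h2, intervalIntegral.integral_zero] at h1
  exact tendsto_nhds_unique h1 tendsto_const_nhds

/-- Dynamic programming along trajectories of the optimal law. -/
theorem value_add_cost (hx₀ : x₀ ∈ P.Ω) (hx : P.IsTrajectory α u x₀ x) {t : ℝ} (ht : 0 ≤ t) :
    φ (x t) + ∫ s in (0 : ℝ)..t, P.runningCost α (x s) (u (x s)) = φ x₀ := by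
  have h1 := hopt x₀ hx₀ x hx
  -- One law is optimal from every state, so the tail of a trajectory has cost exactly `φ (x t)`.
  have h2 := hopt _ (hx.mem ht) _ (hx.shift ht)
  have h3 : Tendsto (fun T : ℝ => ∫ s in (0 : ℝ)..(t + T), P.runningCost α (x s) (u (x s))) atTop
      (𝓝 (φ x₀)) := h1.comp (tendsto_atTop_add_const_left _ t tendsto_id)
  have h4 := h2.add_const (∫ s in (0 : ℝ)..t, P.runningCost α (x s) (u (x s)))
  refine tendsto_nhds_unique (h4.congr' ?_) h3
  filter_upwards [eventually_ge_atTop 0] with T hT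
  have h5 := intervalIntegral.integral_comp_add_left (a := 0) (b := T)
    (fun s => P.runningCost α (x s) (u (x s))) t
  rw [h5, add_zero, add_comm]
  exact intervalIntegral.integral_add_adjacent_intervals
    (hx.intervalIntegrable_runningCost hP hu.continuousOn le_rfl ht)
    (hx.intervalIntegrable_runningCost hP hu.continuousOn ht (by positivity))

/-- Value plus spent cost is constant along the optimal trajectory from `y`; its one-sided
derivative at time `0` is the Hamiltonian. -/
theorem hamiltonian_eq_zero (hφ : ∀ y ∈ P.Ω, DifferentiableAt ℝ φ y) {y : EuclideanSpace ℝ (Fin n)}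
    (hy : y ∈ P.Ω) : P.hamiltonian α φ y (u y) = 0 := by
  obtain ⟨x, hx⟩ := hu.exists_trajectory y hy
  have h1 := hx.hasDerivWithinAt_value_add_cost hP hu.continuousOn hφ le_rfl
  have h2 : HasDerivWithinAt
      (fun T => φ (x T) + ∫ s in (0 : ℝ)..T, P.runningCost α (x s) (u (x s))) 0 (Ici 0) 0 :=
    (hasDerivWithinAt_const 0 (Ici (0 : ℝ)) (φ y)).congr
      (fun t ht => value_add_cost hP hu hopt hy hx ht) (value_add_cost hP hu hopt hy hx le_rfl)
  have h3 := (uniqueDiffWithinAt_Ici (0 : ℝ)).eq_deriv _ h1 h2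
  rwa [hx.1] at h3

/-- The minimum index grows at least quadratically. -/
theorem exists_mul_sq_norm_le_value (hφ : ∀ y ∈ P.Ω, DifferentiableAt ℝ φ y) :
    ∃ c > 0, ∀ y ∈ P.Ω, c * ‖y‖ ^ 2 ≤ φ y := by
  obtain ⟨d, hd, hL⟩ := hP.exists_mul_le_runningCost
  obtain ⟨K, hK, hv⟩ := hP.exists_norm_velocity_le
  refine ⟨d / (4 * K + 1), by positivity, fun y hy => ?_⟩
  obtain ⟨x, hx⟩ := hu.exists_trajectory y hy
  -- This quantity decreases to the limit `0`, so it starts nonnegative. Indeed `‖x‖²` changes at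
  -- rate at most `4K (‖x‖² + ‖u‖²)`, which the running cost dominates; the `+ 1` keeps the
  -- coefficient positive when `K = 0`.
  have h1 : AntitoneOn (fun t => (4 * K + 1) * φ (x t) - d * ‖x t‖ ^ 2) (Ici 0) := by
    refine antitoneOn_Ici_of_hasDerivWithinAt_nonpos (fun t ht =>
      ((hx.hasDerivWithinAt_comp hφ ht).const_mul (4 * K + 1)).sub
        (((hx.2 t ht).2.norm_sq).const_mul d)) fun t ht => ?_
    have e1 := hamiltonian_eq_zero hP hu hopt hφ (hx.mem ht)
    have e2 := hL _ (hx.mem ht) (u (x t))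
    have e3 := hv _ (hx.mem ht) (u (x t))
    have e4 := (abs_le.1 (abs_real_inner_le_norm (x t) (P.velocity α (x t) (u (x t))))).1
    have e5 : ‖x t‖ * ‖P.velocity α (x t) (u (x t))‖ ≤
        2 * K * (‖x t‖ ^ 2 + ‖u (x t)‖ ^ 2) := by
      have := mul_le_mul_of_nonneg_left e3 (norm_nonneg (x t))
      nlinarith [mul_nonneg hK (sq_nonneg (‖x t‖ - ‖u (x t)‖)), mul_nonneg hK (sq_nonneg ‖u (x t)‖),
        mul_nonneg hK (sq_nonneg ‖x t‖)]
    have e6 := hP.runningCost_nonneg (hx.mem ht) (u (x t))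
    unfold hamiltonian at e1
    rw [eq_neg_of_add_eq_zero_left e1]
    have e7 := mul_le_mul_of_nonneg_left e2 hK
    have e8 := mul_le_mul_of_nonneg_left e5 hd.le
    have e9 := mul_le_mul_of_nonneg_left e4 hd.le
    linarith
  have h0 := hu.tendsto_zero y hy x hx
  have h2 : Tendsto (fun t => (4 * K + 1) * φ (x t) - d * ‖x t‖ ^ 2) atTop (𝓝 0) := by
    have e1 : Tendsto (fun t => φ (x t)) atTop (𝓝 0) := by
      have := (hφ 0 (interior_subset hP.zero_mem)).continuousAt.tendsto.comp h0
      rwa [value_zero hP hu hopt] at this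
    simpa using (e1.const_mul (4 * K + 1)).sub ((h0.norm.pow 2).const_mul d)
  have h3 : 0 ≤ (4 * K + 1) * φ (x 0) - d * ‖x 0‖ ^ 2 := by
    refine le_of_tendsto h2 ?_
    filter_upwards [eventually_ge_atTop 0] with t ht
    exact h1 (mem_Ici.2 le_rfl) (mem_Ici.2 ht) ht
  rw [hx.1] at h3
  rw [div_mul_eq_mul_div, div_le_iff₀ (by positivity)]
  linarith

end Optimal

end ControlProblem

/-! ### Steering the linearized system. -/

/-- Controllability steers all states to the origin, in unit time, with controls and states
bounded linearly in the initial state. -/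
theorem CompletelyControllable.exists_bounded_steering {n p : ℕ} {A : Matrix (Fin n) (Fin n) ℝ}
    {B : Matrix (Fin n) (Fin p) ℝ} (h : CompletelyControllable A B) :
    ∃ M, 0 ≤ M ∧ ∀ x₀ : EuclideanSpace ℝ (Fin n), ∃ (v : ℝ → EuclideanSpace ℝ (Fin p))
      (z : ℝ → EuclideanSpace ℝ (Fin n)), z 0 = x₀ ∧ z 1 = 0 ∧ ∀ t ∈ Icc (0 : ℝ) 1,
        ‖v t‖ ≤ M * ‖x₀‖ ∧ ‖z t‖ ≤ M * ‖x₀‖ ∧ HasDerivWithinAt z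
          (WithLp.toLp 2 (A.mulVec (z t).ofLp + B.mulVec (v t).ofLp)) (Icc 0 1) t := by
  -- Steer each basis vector to `0` and superpose: linearity makes the bounds proportional to
  -- `‖x₀‖`.
  choose v z hv hz0 hz1 hz using fun i : Fin n => h 0 1 one_pos (EuclideanSpace.single i 1) 0
  choose a ha using fun i => isCompact_Icc.exists_bound_of_continuousOn
    (hv i).continuous.continuousOn (s := Icc (0 : ℝ) 1)
  choose b hb using fun i => isCompact_Icc.exists_bound_of_continuousOn (s := Icc (0 : ℝ) 1)
    (f := z i) fun t ht => (hz i t ht).continuousWithinAt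
  have ha0 : ∀ i, 0 ≤ a i := fun i => (norm_nonneg _).trans (ha i 0 (by simp))
  have hb0 : ∀ i, 0 ≤ b i := fun i => (norm_nonneg _).trans (hb i 0 (by simp))
  refine ⟨∑ i, (a i + b i), Finset.sum_nonneg fun i _ => add_nonneg (ha0 i) (hb0 i), fun x₀ =>
    ⟨fun t => ∑ i, x₀ i • v i t, fun t => ∑ i, x₀ i • z i t, ?_, ?_, fun t ht => ⟨?_, ?_, ?_⟩⟩⟩
  · simp only [hz0]
    simpa using (EuclideanSpace.basisFun (Fin n) ℝ).sum_repr x₀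
  · simp [hz1]
  · rw [Finset.sum_mul]
    refine (norm_sum_le _ _).trans (Finset.sum_le_sum fun i _ => ?_)
    rw [norm_smul, mul_comm]
    gcongr
    · exact add_nonneg (ha0 i) (hb0 i)
    · linarith [ha i t ht, hb0 i]
    · exact PiLp.norm_apply_le x₀ i
  · rw [Finset.sum_mul]
    refine (norm_sum_le _ _).trans (Finset.sum_le_sum fun i _ => ?_)
    rw [norm_smul, mul_comm]
    gcongr
    · exact add_nonneg (ha0 i) (hb0 i)
    · linarith [hb i t ht, ha0 i]
    · exact PiLp.norm_apply_le x₀ i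
  · refine (HasDerivWithinAt.fun_sum fun i _ => (hz i t ht).const_smul (x₀ i)).congr_deriv ?_
    simp only [WithLp.ofLp_sum, WithLp.ofLp_smul, Matrix.mulVec_sum, Matrix.mulVec_smul,
      ← Finset.sum_add_distrib, ← smul_add, WithLp.toLp_sum, WithLp.toLp_smul]

/-! ### The Hamilton–Jacobi–Bellman inequality and its consequences. -/

namespace ControlProblem

variable {n p q : ℕ} {P : ControlProblem n p q} {α : EuclideanSpace ℝ (Fin q)}
  {u : EuclideanSpace ℝ (Fin n) → EuclideanSpace ℝ (Fin p)}
  {φ : EuclideanSpace ℝ (Fin n) → ℝ}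

theorem StandingAssumptions.continuousOn_hamiltonian (hP : P.StandingAssumptions α)
    (hφ : ∀ y ∈ P.Ω, ContDiffAt ℝ 1 φ y) (v : EuclideanSpace ℝ (Fin p)) :
    ContinuousOn (fun y => P.hamiltonian α φ y v) P.Ω := by
  have h1 : ContinuousOn (fderiv ℝ φ) P.Ω := fun y hy =>
    ((hφ y hy).fderiv_right (m := 0) (by norm_num)).continuousAt.continuousWithinAt
  exact (h1.clm_apply (hP.continuousOn_velocity continuousOn_const)).add
    (hP.continuousOn_runningCost continuousOn_const)

/-- Changing an admissible law in the interior of the region keeps the closed loop solvable. -/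
theorem IsAdmissible.exists_trajectory_of_eqOn_diff_interior (hu : P.IsAdmissible α u)
    (hP : P.StandingAssumptions α) {w : EuclideanSpace ℝ (Fin n) → EuclideanSpace ℝ (Fin p)}
    (hw : ContinuousOn w P.Ω) (heq : EqOn w u (P.Ω \ interior P.Ω))
    {x₀ : EuclideanSpace ℝ (Fin n)} (hx₀ : x₀ ∈ P.Ω) : ∃ x, P.IsTrajectory α w x₀ x := by
  refine exists_viable_solution hP.isCompact_Ω (F := fun y => P.velocity α y (w y))
    (hP.continuousOn_velocity hw) (fun y hy ε hε => ?_) hx₀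
  by_cases hyi : y ∈ interior P.Ω
  · have h1 : ∀ᶠ h : ℝ in 𝓝 0, y + h • P.velocity α y (w y) ∈ P.Ω := by
      have hc : ContinuousAt (fun h : ℝ => y + h • P.velocity α y (w y)) 0 := by fun_prop
      refine hc.eventually_mem ?_
      simpa using mem_interior_iff_mem_nhds.1 hyi
    have h2 : ∀ᶠ h : ℝ in 𝓝[>] 0, 0 < h ∧ h ≤ ε :=
      (eventually_mem_nhdsWithin).and (nhdsWithin_le_nhds (eventually_le_nhds hε))
    obtain ⟨h, hh, h0, hle⟩ := ((h1.filter_mono nhdsWithin_le_nhds).and h2).exists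
    exact ⟨h, h0, hle, _, hh, by simpa using mul_nonneg hε.le h0.le⟩
  -- At a boundary point the field is that of `u`, whose own trajectory in `Ω` witnesses tangency.
  · obtain ⟨x, hx⟩ := hu.exists_trajectory y hy
    have h1 := (hx.2 0 le_rfl).2
    rw [hx.1, ← heq ⟨hy, hyi⟩, hasDerivWithinAt_iff_isLittleO] at h1
    have h3 : ∀ᶠ h : ℝ in 𝓝[>] 0, _ :=
      nhdsWithin_mono _ Ioi_subset_Ici_self (h1.def hε)
    have h2 : ∀ᶠ h : ℝ in 𝓝[>] 0, 0 < h ∧ h ≤ ε :=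
      (eventually_mem_nhdsWithin).and (nhdsWithin_le_nhds (eventually_le_nhds hε))
    obtain ⟨h, hh, h0, hle⟩ := (h3.and h2).exists
    refine ⟨h, h0, hle, x h, hx.mem h0.le, ?_⟩
    simpa [hx.1, abs_of_pos h0] using hh

section Optimal

variable (hP : P.StandingAssumptions α) (hφ : ∀ y ∈ P.Ω, ContDiffAt ℝ 1 φ y)
  (hu : P.IsAdmissible α u)
  (hopt : ∀ x₀ ∈ P.Ω, ∀ x, P.IsTrajectory α u x₀ x → P.HasCost α u x (φ x₀))
  (hmin : ∀ u, P.IsAdmissible α u → ∀ x₀ ∈ P.Ω, ∀ x, P.IsTrajectory α u x₀ x →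
    ∀ c, P.HasCost α u x c → φ x₀ ≤ c)
include hP hφ hu hopt

/-- A modification of the optimal law in the interior, with nonpositive Hamiltonian, is admissible,
and cheaper from the states at which its Hamiltonian is negative. -/
theorem exists_cheaper_law {w : EuclideanSpace ℝ (Fin n) → EuclideanSpace ℝ (Fin p)}
    (hw : ContinuousOn w P.Ω) (hw0 : w 0 = 0) (heq : EqOn w u (P.Ω \ interior P.Ω))
    (hH : ∀ y ∈ P.Ω, P.hamiltonian α φ y (w y) ≤ 0) {x₁ : EuclideanSpace ℝ (Fin n)}
    (hx₁ : x₁ ∈ P.Ω) (hneg : P.hamiltonian α φ x₁ (w x₁) < 0) :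
    P.IsAdmissible α w ∧ ∃ x c, P.IsTrajectory α w x₁ x ∧ P.HasCost α w x c ∧ c < φ x₁ := by
  have hd : ∀ y ∈ P.Ω, DifferentiableAt ℝ φ y := fun y hy => (hφ y hy).differentiableAt (by norm_num)
  obtain ⟨c, hc, hφc⟩ := exists_mul_sq_norm_le_value hP hu hopt hd
  have hφ0 := value_zero hP hu hopt
  have hex : ∀ x₀ ∈ P.Ω, ∃ x, P.IsTrajectory α w x₀ x := fun x₀ hx₀ =>
    hu.exists_trajectory_of_eqOn_diff_interior hP hw heq hx₀
  have hlim : ∀ x₀ ∈ P.Ω, ∀ x, P.IsTrajectory α w x₀ x → Tendsto x atTop (𝓝 0) :=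
    fun x₀ _ x hx => hx.tendsto_zero_of_hamiltonian_nonpos hP hd hφ0 hc hφc hH
  have hcost : ∀ x₀ ∈ P.Ω, ∀ x, P.IsTrajectory α w x₀ x → ∃ c, P.HasCost α w x c :=
    fun x₀ _ x hx => hx.exists_hasCost_of_hamiltonian_nonpos hP hw hd
      (fun y hy => le_trans (by positivity) (hφc y hy)) hH
  refine ⟨⟨hw, hw0, hex, hlim, hcost⟩, ?_⟩
  obtain ⟨x, hx⟩ := hex x₁ hx₁
  obtain ⟨k, hk⟩ := hcost x₁ hx₁ x hx
  refine ⟨x, k, hx, hk, ?_⟩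
  -- Value plus spent cost is nonincreasing from `φ x₁` to its limit `k`. If `φ x₁ ≤ k` it is
  -- constant, so the Hamiltonian vanishes at the start, against `hneg`.
  by_contra! hle
  have hder := fun t (ht : (0 : ℝ) ≤ t) => hx.hasDerivWithinAt_value_add_cost hP hw hd ht
  have hanti := antitoneOn_Ici_of_hasDerivWithinAt_nonpos hder fun t ht => hH _ (hx.mem ht)
  have htend : Tendsto (fun T => φ (x T) + ∫ s in (0 : ℝ)..T, P.runningCost α (x s) (w (x s)))
      atTop (𝓝 k) := by
    have e1 := (hd 0 (interior_subset hP.zero_mem)).continuousAt.tendsto.comp (hlim x₁ hx₁ x hx)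
    rw [hφ0] at e1
    simpa using e1.add hk
  have hge : ∀ t, 0 ≤ t →
      k ≤ φ (x t) + ∫ s in (0 : ℝ)..t, P.runningCost α (x s) (w (x s)) := by
    intro t ht
    refine le_of_tendsto htend ?_
    filter_upwards [eventually_ge_atTop t] with T hT
    exact hanti (mem_Ici.2 ht) (mem_Ici.2 (ht.trans hT)) hT
  have hconst : ∀ t, 0 ≤ t →
      φ (x t) + ∫ s in (0 : ℝ)..t, P.runningCost α (x s) (w (x s)) = φ x₁ := by
    intro t ht
    have e1 := hanti (mem_Ici.2 le_rfl) (mem_Ici.2 ht) ht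
    simp only [intervalIntegral.integral_same, add_zero, hx.1] at e1
    exact le_antisymm e1 (hle.trans (hge t ht))
  have h2 : HasDerivWithinAt
      (fun T => φ (x T) + ∫ s in (0 : ℝ)..T, P.runningCost α (x s) (w (x s))) 0 (Ici 0) 0 :=
    (hasDerivWithinAt_const 0 (Ici (0 : ℝ)) (φ x₁)).congr
      (fun t ht => hconst t ht) (hconst 0 le_rfl)
  have h3 := (uniqueDiffWithinAt_Ici (0 : ℝ)).eq_deriv _ (hder 0 le_rfl) h2
  rw [hx.1] at h3
  linarith

include hmin

theorem hamiltonian_nonneg_of_mem_interior {x₁ : EuclideanSpace ℝ (Fin n)}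
    (hx₁ : x₁ ∈ interior P.Ω) (hne : x₁ ≠ 0) (v : EuclideanSpace ℝ (Fin p)) :
    0 ≤ P.hamiltonian α φ x₁ v := by
  by_contra! hneg
  have hd : ∀ y ∈ P.Ω, DifferentiableAt ℝ φ y := fun y hy => (hφ y hy).differentiableAt (by norm_num)
  have hHu : ∀ y ∈ P.Ω, P.hamiltonian α φ y (u y) = 0 := fun y hy =>
    hamiltonian_eq_zero hP hu hopt hd hy
  -- The perturbation must spare the boundary, to keep the closed loop solvable, and the origin,
  -- where an admissible law vanishes.
  have hnhds : ∀ᶠ y in 𝓝 x₁, y ∈ interior P.Ω ∧ y ≠ 0 ∧ P.hamiltonian α φ y v < 0 := by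
    refine (isOpen_interior.eventually_mem hx₁).and ((eventually_ne_nhds hne).and ?_)
    exact ((hP.continuousOn_hamiltonian hφ v).continuousAt
      (mem_interior_iff_mem_nhds.1 hx₁)).eventually_lt_const hneg
  obtain ⟨r, hr, hball⟩ := Metric.eventually_nhds_iff_ball.1 hnhds
  let χ : EuclideanSpace ℝ (Fin n) → ℝ := fun y => max 0 (1 - dist y x₁ / r)
  have hχ0 : ∀ y, 0 ≤ χ y := fun y => le_max_left _ _
  have hχ1 : ∀ y, χ y ≤ 1 := fun y => max_le zero_le_one (by
    have : 0 ≤ dist y x₁ / r := by positivity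
    linarith)
  have hχout : ∀ y, y ∉ Metric.ball x₁ r → χ y = 0 := by
    intro y hy
    refine max_eq_left ?_
    rw [Metric.mem_ball, not_lt] at hy
    have : 1 ≤ dist y x₁ / r := (one_le_div hr).2 hy
    linarith
  have hχc : Continuous χ := by fun_prop
  let w : EuclideanSpace ℝ (Fin n) → EuclideanSpace ℝ (Fin p) := fun y => u y + χ y • (v - u y)
  have hwout : ∀ y, y ∉ Metric.ball x₁ r → w y = u y := fun y hy => by simp [w, hχout y hy]
  have hw : ContinuousOn w P.Ω :=
    hu.continuousOn.add (hχc.continuousOn.smul (continuousOn_const.sub hu.continuousOn))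
  have hw0 : w 0 = 0 := by
    rw [hwout 0 fun h => (hball 0 h).2.1 rfl, hu.map_zero]
  have hwx : w x₁ = v := by simp [w, χ]
  obtain ⟨hadm, x, c, hx, hc, hlt⟩ := exists_cheaper_law hP hφ hu hopt hw hw0
    (fun y hy => hwout y fun h => hy.2 (hball y h).1) (fun y hy => by
      by_cases h : y ∈ Metric.ball x₁ r
      · refine (hamiltonian_convex hP.R_posDef y (u y) v (hχ0 y) (hχ1 y)).trans ?_
        rw [hHu y hy, mul_zero, zero_add]
        exact mul_nonpos_of_nonneg_of_nonpos (hχ0 y) (hball y h).2.2.le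
      · rw [hwout y h, hHu y hy])
    (interior_subset hx₁) (by rwa [hwx])
  exact hlt.not_ge (hmin w hadm x₁ (interior_subset hx₁) x hx c hc)

/-- The Hamilton–Jacobi–Bellman inequality. -/
theorem hamiltonian_nonneg {y : EuclideanSpace ℝ (Fin n)} (hy : y ∈ P.Ω)
    (v : EuclideanSpace ℝ (Fin p)) : 0 ≤ P.hamiltonian α φ y v := by
  have hd : ∀ y ∈ P.Ω, DifferentiableAt ℝ φ y := fun y hy => (hφ y hy).differentiableAt (by norm_num)
  have h0 : fderiv ℝ φ 0 = 0 := by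
    obtain ⟨c, hc, hφc⟩ := exists_mul_sq_norm_le_value hP hu hopt hd
    refine IsLocalMin.fderiv_eq_zero ?_
    filter_upwards [hP.mem_nhds] with x hx
    rw [value_zero hP hu hopt]
    exact le_trans (by positivity) (hφc x hx)
  have hint : ∀ x ∈ interior P.Ω, 0 ≤ P.hamiltonian α φ x v := by
    intro x hx
    by_cases hne : x = 0
    · rw [hne, hamiltonian, h0]
      simpa using hP.runningCost_nonneg (interior_subset hP.zero_mem) v
    · exact hamiltonian_nonneg_of_mem_interior hP hφ hu hopt hmin hx hne v
  -- Boundary points are limits of interior ones and the Hamiltonian is continuous in the state.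
  rw [← hP.closure_interior_Ω] at hy
  have hc := (hP.continuousOn_hamiltonian hφ v).mono
    (show closure (interior P.Ω) ⊆ P.Ω from hP.closure_interior_Ω.le)
  have := hc.image_closure
  exact closure_minimal (t := Ici (0 : ℝ)) (by rintro _ ⟨x, hx, rfl⟩; exact hint x hx) isClosed_Ici
    (this (mem_image_of_mem _ hy))

/-- Completing the square, `0 = H(u) = H(u*) + (u - u*)ᵀ R (u - u*)` with `H(u*) ≥ 0`, so the
positive definite term vanishes. -/
theorem eqOn_optimalLaw : EqOn u (P.optimalLaw α φ) P.Ω := by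
  intro y hy
  have hd : ∀ y ∈ P.Ω, DifferentiableAt ℝ φ y := fun y hy => (hφ y hy).differentiableAt (by norm_num)
  obtain ⟨c, hc, hR⟩ := hP.R_posDef.exists_mul_sq_norm_le
  have h1 := hamiltonian_optimalLaw_add (α := α) (φ := φ) hP.R_posDef y (u y - P.optimalLaw α φ y)
  rw [add_sub_cancel, hamiltonian_eq_zero hP hu hopt hd hy] at h1
  have h2 := hamiltonian_nonneg hP hφ hu hopt hmin hy (P.optimalLaw α φ y)
  have h3 := hR (u y - P.optimalLaw α φ y)
  have h4 : ‖u y - P.optimalLaw α φ y‖ ^ 2 ≤ 0 :=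
    nonpos_of_mul_nonpos_right (by linarith) hc
  rw [← sub_eq_zero, ← norm_eq_zero]
  exact pow_eq_zero_iff two_ne_zero |>.1 (le_antisymm h4 (by positivity))

/-- Controllability of the linearization bounds the minimum index quadratically. -/
theorem exists_value_le_mul_sq_norm
    (hcontr : CompletelyControllable (jacobianMatrix (fun y => P.f y α) 0) (P.g 0 α)) :
    ∃ C > 0, ∀ y ∈ P.Ω, φ y ≤ C * ‖y‖ ^ 2 := by
  have hd : ∀ y ∈ P.Ω, DifferentiableAt ℝ φ y := fun y hy => (hφ y hy).differentiableAt (by norm_num)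
  obtain ⟨M, hM, hsteer⟩ := hcontr.exists_bounded_steering
  obtain ⟨C, r, hC, hr, hlin⟩ := hP.exists_norm_velocity_sub_linearization_le
  obtain ⟨D, r', hD, hr', hL⟩ := hP.exists_runningCost_le
  obtain ⟨r'', hr'', hball⟩ := Metric.mem_nhds_iff.1 hP.mem_nhds
  obtain ⟨Φ, hΦ⟩ := hP.isCompact_Ω.exists_bound_of_continuousOn (f := fderiv ℝ φ) fun y hy =>
    ((hφ y hy).fderiv_right (m := 0) (by norm_num)).continuousAt.continuousWithinAt
  have hΦ0 : 0 ≤ Φ := (norm_nonneg _).trans (hΦ 0 (interior_subset hP.zero_mem))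
  obtain ⟨B, hB⟩ := hP.isCompact_Ω.exists_bound_of_continuousOn (f := φ) fun y hy =>
    (hd y hy).continuousAt.continuousWithinAt
  have hB0 : 0 ≤ B := (norm_nonneg _).trans (hB 0 (interior_subset hP.zero_mem))
  let s := min r (min r' r'')
  have hs : 0 < s := lt_min hr (lt_min hr' hr'')
  -- The first term bounds the running cost on the steering curve, the second the effect on `φ` of
  -- the linearization error.
  let N := 2 * D * M ^ 2 + 2 * Φ * C * M ^ 2
  have hlocal : ∀ y, M * ‖y‖ < s → φ y ≤ N * ‖y‖ ^ 2 := by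
    intro y hy
    obtain ⟨v, z, hz0, hz1, hz⟩ := hsteer y
    have hzs : ∀ t ∈ Icc (0 : ℝ) 1, ‖z t‖ < s := fun t ht => (hz t ht).2.1.trans_lt hy
    have hzΩ : ∀ t ∈ Icc (0 : ℝ) 1, z t ∈ P.Ω := fun t ht => hball (mem_ball_zero_iff.2
      ((hzs t ht).trans_le ((min_le_right _ _).trans (min_le_right _ _))))
    have hder : ∀ t ∈ Icc (0 : ℝ) 1, HasDerivWithinAt (fun t => φ (z t) + N * ‖y‖ ^ 2 * t)
        (fderiv ℝ φ (z t) (WithLp.toLp 2 ((jacobianMatrix (fun y => P.f y α) 0).mulVec (z t).ofLp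
          + (P.g 0 α).mulVec (v t).ofLp)) + N * ‖y‖ ^ 2 * 1) (Icc 0 1) t := fun t ht =>
      ((hd _ (hzΩ t ht)).hasFDerivAt.comp_hasDerivWithinAt t (hz t ht).2.2).add
        ((hasDerivAt_id t).const_mul (N * ‖y‖ ^ 2)).hasDerivWithinAt
    have hmono : MonotoneOn (fun t => φ (z t) + N * ‖y‖ ^ 2 * t) (Icc 0 1) := by
      refine monotoneOn_of_hasDerivWithinAt_nonneg (convex_Icc 0 1)
        (fun t ht => (hder t ht).continuousWithinAt)
        (fun t ht => (hder t (interior_subset ht)).mono interior_subset) fun t ht => ?_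
      replace ht := interior_subset ht
      obtain ⟨b1, b2, -⟩ := hz t ht
      -- The curve `z` need not solve the nonlinear system, nor `v` come from a feedback law: the
      -- inequality is pointwise in state and control, and the mismatch of velocities is already
      -- quadratic in `‖y‖`.
      have e1 := hamiltonian_nonneg hP hφ hu hopt hmin (hzΩ t ht) (v t)
      have e2 := hL (z t) ((hzs t ht).trans_le ((min_le_right _ _).trans (min_le_left _ _))) (v t)
      have e3 := hlin (z t) ((hzs t ht).trans_le (min_le_left _ _)) (v t)
      set ℓ := WithLp.toLp 2 ((jacobianMatrix (fun y => P.f y α) 0).mulVec (z t).ofLp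
          + (P.g 0 α).mulVec (v t).ofLp)
      have e4 : fderiv ℝ φ (z t) ℓ = fderiv ℝ φ (z t) (P.velocity α (z t) (v t))
          - fderiv ℝ φ (z t) (P.velocity α (z t) (v t) - ℓ) := by rw [map_sub]; ring
      have e5 : fderiv ℝ φ (z t) (P.velocity α (z t) (v t) - ℓ) ≤
          Φ * (C * (M * ‖y‖ + M * ‖y‖) * (M * ‖y‖)) := by
        refine (le_abs_self _).trans (((fderiv ℝ φ (z t)).le_opNorm _).trans ?_)
        gcongr
        · exact hΦ _ (hzΩ t ht)
        · refine e3.trans ?_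
          gcongr
      have e6 : D * (‖z t‖ ^ 2 + ‖v t‖ ^ 2) ≤ D * ((M * ‖y‖) ^ 2 + (M * ‖y‖) ^ 2) := by gcongr
      unfold hamiltonian at e1
      rw [e4]
      simp only [N]
      linarith
    have := hmono (by simp) (by simp) zero_le_one
    simpa [hz0, hz1, value_zero hP hu hopt] using this
  have hN : 0 ≤ N := by positivity
  -- When `M * ‖y‖ ≥ s`, the bound `φ ≤ B` is itself quadratic, with constant `B * M ^ 2 / s ^ 2`.
  refine ⟨N + B * M ^ 2 / s ^ 2 + 1, by positivity, fun y hy => ?_⟩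
  rcases lt_or_ge (M * ‖y‖) s with h | h
  · refine (hlocal y h).trans ?_
    gcongr
    have : 0 ≤ B * M ^ 2 / s ^ 2 := by positivity
    linarith
  · have e1 : φ y ≤ B := (le_abs_self _).trans (hB y hy)
    have e2 : s ^ 2 ≤ (M * ‖y‖) ^ 2 := by gcongr
    have e3 : B ≤ B * M ^ 2 / s ^ 2 * ‖y‖ ^ 2 := by
      rw [div_mul_eq_mul_div, le_div_iff₀ (by positivity)]
      have := mul_le_mul_of_nonneg_left e2 hB0
      linarith
    have e4 : 0 ≤ (N + 1) * ‖y‖ ^ 2 := by positivity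
    linarith

/-- The optimal law is exponentially stabilizing, with a uniform constant. -/
theorem exists_exponential_bound
    (hcontr : CompletelyControllable (jacobianMatrix (fun y => P.f y α) 0) (P.g 0 α)) :
    ∃ K lam : ℝ, 0 < K ∧ 0 < lam ∧ ∀ x₀ ∈ P.Ω, ∀ x, P.IsTrajectory α u x₀ x →
      ∀ t, 0 ≤ t → ‖x t‖ ≤ K * ‖x₀‖ * Real.exp (-lam * t) := by
  have hd : ∀ y ∈ P.Ω, DifferentiableAt ℝ φ y := fun y hy => (hφ y hy).differentiableAt (by norm_num)
  obtain ⟨d, hd0, hL⟩ := hP.exists_mul_le_runningCost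
  obtain ⟨c, hc, hlow⟩ := exists_mul_sq_norm_le_value hP hu hopt hd
  obtain ⟨C, hC, hup⟩ := exists_value_le_mul_sq_norm hP hφ hu hopt hmin hcontr
  -- `φ` decays at rate `d / C`. Passing from `φ` to `‖x‖` through `c‖x‖² ≤ φ ≤ C‖x‖²` takes a
  -- square root, which halves the rate.
  refine ⟨√(C / c), d / C / 2, by positivity, by positivity, fun x₀ hx₀ x hx t ht => ?_⟩
  have hanti : AntitoneOn (fun t => φ (x t) * Real.exp (d / C * t)) (Ici 0) := by
    refine antitoneOn_Ici_of_hasDerivWithinAt_nonpos (fun t ht =>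
      (hx.hasDerivWithinAt_comp hd ht).mul
        (((hasDerivAt_id t).const_mul (d / C)).exp).hasDerivWithinAt) fun t ht => ?_
    have e1 := hamiltonian_eq_zero hP hu hopt hd (hx.mem ht)
    have e2 := hL _ (hx.mem ht) (u (x t))
    have e3 : d / C * φ (x t) ≤ d * ‖x t‖ ^ 2 := by
      rw [div_mul_eq_mul_div, div_le_iff₀ hC]
      have := mul_le_mul_of_nonneg_left (hup _ (hx.mem ht)) hd0.le
      linarith
    have e4 : 0 ≤ d * ‖u (x t)‖ ^ 2 := by positivity
    unfold hamiltonian at e1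
    have e5 := Real.exp_pos (d / C * t)
    have e6 : fderiv ℝ φ (x t) (P.velocity α (x t) (u (x t))) + d / C * φ (x t) ≤ 0 := by linarith
    simp only [id, mul_one]
    have := mul_nonpos_of_nonpos_of_nonneg e6 e5.le
    linarith
  have h1 := hanti (mem_Ici.2 le_rfl) (mem_Ici.2 ht) ht
  simp only [mul_zero, Real.exp_zero, mul_one, hx.1] at h1
  have h2 := hlow _ (hx.mem ht)
  have h3 := hup _ hx₀
  have h4 : Real.exp (-(d / C / 2) * t) ^ 2 * Real.exp (d / C * t) = 1 := by
    rw [← Real.exp_nat_mul, ← Real.exp_add, ← Real.exp_zero]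
    congr 1
    push_cast
    ring
  refine le_of_sq_le_sq ?_ (by positivity)
  rw [mul_pow, mul_pow, Real.sq_sqrt (by positivity), div_mul_eq_mul_div, div_mul_eq_mul_div,
    le_div_iff₀ hc]
  have h5 : c * ‖x t‖ ^ 2 * Real.exp (d / C * t) ≤ C * ‖x₀‖ ^ 2 :=
    (mul_le_mul_of_nonneg_right h2 (Real.exp_pos _).le).trans (h1.trans h3)
  have h6 := mul_le_mul_of_nonneg_left h5 (sq_nonneg (Real.exp (-(d / C / 2) * t)))
  calc ‖x t‖ ^ 2 * c = c * ‖x t‖ ^ 2 *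
        (Real.exp (-(d / C / 2) * t) ^ 2 * Real.exp (d / C * t)) := by rw [h4]; ring
    _ ≤ _ := by linarith

end Optimal

end ControlProblem

theorem theorem2 {n p q : ℕ} (P : ControlProblem n p q) (α : EuclideanSpace ℝ (Fin q))
    (hP : P.StandingAssumptions α)
    (φ : EuclideanSpace ℝ (Fin n) → ℝ)
    (hφ : P.IsMinimumIndex α φ)
    (hφ_smooth : ∀ x ∈ P.Ω, ContDiffAt ℝ 1 φ x)
    (ρ : ℝ) (hρ : 0 < ρ)
    (hf : ∀ i, BoundedLipschitzGradientOn (fun y => P.f y α i) {x | x ∈ P.Ω ∧ ‖x‖ < ρ})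
    (hg : ∀ i j, BoundedLipschitzGradientOn (fun y => P.g y α i j) {x | x ∈ P.Ω ∧ ‖x‖ < ρ})
    (hm : BoundedLipschitzGradientOn (fun y => P.m y α) {x | x ∈ P.Ω ∧ ‖x‖ < ρ})
    (hcontr : CompletelyControllable (jacobianMatrix (fun y => P.f y α) 0) (P.g 0 α))
    (hobs : CompletelyObservable (jacobianMatrix (fun y => P.f y α) 0)
      (CFC.sqrt (hessianMatrix (fun y => P.m y α) 0))) :
    P.IsUGALES α (P.optimalLaw α φ) := by
  obtain ⟨hmin, u, hu, hopt⟩ := hφ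
  have heq := ControlProblem.eqOn_optimalLaw hP hφ_smooth hu hopt hmin
  obtain ⟨K, lam, hK, hlam, hbound⟩ :=
    ControlProblem.exists_exponential_bound hP hφ_smooth hu hopt hmin hcontr
  -- The quadratic bounds hold on all of `Ω`, so a constant `β` suffices.
  refine ⟨fun x₀ hx₀ => ?_, fun _ => K, lam, monotone_const, continuous_const, fun _ => hK, hlam,
    fun x₀ hx₀ x hx => hbound x₀ hx₀ x (hx.congr heq.symm)⟩
  obtain ⟨x, hx⟩ := hu.exists_trajectory x₀ hx₀
  exact ⟨x, hx.congr heq⟩
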